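/- Let $K$ be a countable field, let $A$ be the free (unital, associative) $K$-algebra in two non-commuting indeterminates, let $M(n)$ be the set of its monomials of degree $n$, let $H(n)=\operatorname{span}_K M(n)$, and let $\bar A\subseteq A$ be the non-unital subalgebra of polynomials with zero constant term. Let $\deg f$ be the least $d\ge 0$ with $f\in H(0)+\dots+H(d)$. Products of subspaces are the spans of the products of their elements, and $\log$ is to base $2$. Consider the following data. (a) A set $Z\subseteq\mathbb N$ with all $i\in Z$ at least $5$, and an enumeration $\{f_i\}_{i\in Z}$ of $\bar A$ such that $\lfloor\log i\rfloor>6^{6\deg f_i}$ for $i\in Z$, and $i>2^{2^{2^{2j}}}$ whenever $i,j\in Z$ and $i>j$. Put $e_i=2^i-\lfloor\log i\rfloor$ and $w_i=4\cdot 2^{e_i}$. (b) For each $i\in Z$, a subspace $F_i\subseteq H(2^{e_i})$ with $\dim_K F_i<2^{2^i}-2$ such that the two-sided ideal of $A$ generated by $f_i^{10w_i}$ is contained in $\sum_{k\ge 0}H(k2^{e_i})F_iA$. (c) Let $S=\bigcup_{i\in Z}\,[\,2^i-i-\lfloor\log i\rfloor,\ 2^i-\lfloor\log i\rfloor-1\,]$.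 Subspaces $U(2^n),V(2^n)\subseteq H(2^n)$, $n\ge 0$, such that for all $n>0$: (1) $\dim_K V(2^n)=2$ if $n\notin S$; (2) $\dim_K V(2^{2^i-i-\lfloor\log i\rfloor+j})=2^{2^j}$ for all $i\in Z$ and $0\le j\le i-1$; (3) $V(2^n)$ is spanned by monomials; (4) $F_i\subseteq U(2^{e_i})$ for every $i\in Z$; (5) $V(2^n)\oplus U(2^n)=H(2^n)$; (6) $H(2^n)U(2^n)+U(2^n)H(2^n)\subseteq U(2^{n+1})$; (7) $V(2^{n+1})\subseteq V(2^n)V(2^n)$; (8) if $n\notin S$, there are monomials $m_1,m_2\in V(2^n)$ with $V(2^n)=Km_1+Km_2$ and $m_2H(2^n)\subseteq U(2^{n+1})$. For $n\ge 1$ with $2^m\le n<2^{m+1}$, let $E(n)$ be the set of $r\in H(n)$ such that for all $0\le j\le 2^{m+2}-n$ $$H(j)\,r\,H(2^{m+2}-j-n)\subseteq U(2^{m+1})H(2^{m+1})+H(2^{m+1})U(2^{m+1}),$$ and let $E=E(1)+E(2)+\cdots$. Theorem. Data as in (a), (b), (c) exist. For all such data, $E$ is contained in $\bar A$ and is a two-sided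 ideal of $\bar A$, the quotient algebra $\bar A/E$ is nil (each of its elements is nilpotent), and $\bar A/E$ is infinite dimensional over $K$. -/

import Mathlib

namespace NilConstruction

noncomputable section

/-- The free `K`-algebra `A` in two non-commuting indeterminates. -/
abbrev A (K : Type*) [Field K] : Type _ := FreeAlgebra K (Fin 2)

section Basic

variable (K : Type*) [Field K]

/-- The monomial of `A` given by a word in the two indeterminates. -/
def monomial (w : List (Fin 2)) : A K := (w.map (FreeAlgebra.ι K)).prod

/-- `M(n)`: the set of monomials of degree `n`. -/
def M (n : ℕ) : Set (A K) := {a | ∃ w : List (Fin 2), w.length = n ∧ monomial K w = a}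

/-- `H(n)`: the space of homogeneous polynomials of degree `n`. -/
def H (n : ℕ) : Submodule K (A K) := Submodule.span K (M K n)

/-- `Ā`: the (non-unital) subalgebra of polynomials with constant term zero. -/
def Abar : NonUnitalSubalgebra K (A K) where
  carrier := {a | FreeAlgebra.algebraMapInv a = 0}
  add_mem' := by
    intro a b ha hb
    simp only [Set.mem_ofPred_eq] at ha hb ⊢
    rw [map_add, ha, hb, add_zero]
  zero_mem' := by simp
  mul_mem' := by
    intro a b ha hb
    simp only [Set.mem_ofPred_eq] at ha hb ⊢
    rw [map_mul, ha, zero_mul]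
  smul_mem' := by
    intro c a ha
    simp only [Set.mem_ofPred_eq] at ha ⊢
    rw [map_smul, ha, smul_zero]

end Basic

variable {K : Type*} [Field K]

/-- The degree of `f`: the least `d ≥ 0` with `f ∈ H(0) + ... + H(d)` (so `deg 0 = 0`). -/
def deg (f : A K) : ℕ := sInf {d | f ∈ ⨆ (k : ℕ) (_ : k ≤ d), H K k}

/-- A set `Z` of natural numbers `≥ 5` and an enumeration `f` of `Ā` by `Z` with fast growing
indices. Here `Nat.log 2 i` is `⌊log₂ i⌋`. -/
structure IsSparseEnumeration (Z : Set ℕ) (f : ℕ → A K) : Prop where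
  five_le : ∀ i ∈ Z, 5 ≤ i
  enumerates : f '' Z = (Abar K : Set (A K))
  deg_lt : ∀ i ∈ Z, 6 ^ (6 * deg (f i)) < Nat.log 2 i
  sparse : ∀ i ∈ Z, ∀ j ∈ Z, j < i → 2 ^ 2 ^ 2 ^ (2 * j) < i

/-- The exponent `2^i - ⌊log₂ i⌋`. -/
def ex (i : ℕ) : ℕ := 2 ^ i - Nat.log 2 i

/-- Spaces `F_i ⊆ H(2^(2^i - ⌊log i⌋))` of dimension less than `2^(2^i) - 2`, such that the
two-sided ideal of `A` generated by `f_i^(10 w_i)`, with `w_i = 4 · 2^(2^i - ⌊log i⌋)`, lies in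
`∑_k H(k 2^(2^i - ⌊log i⌋)) F_i A`. -/
structure IsCapturing (Z : Set ℕ) (f : ℕ → A K) (F : ℕ → Submodule K (A K)) : Prop where
  le_H : ∀ i ∈ Z, F i ≤ H K (2 ^ ex i)
  finrank_lt : ∀ i ∈ Z, Module.finrank K (F i) < 2 ^ 2 ^ i - 2
  ideal_le : ∀ i ∈ Z, ∀ g ∈ TwoSidedIdeal.span {f i ^ (10 * (4 * 2 ^ ex i))},
    g ∈ ⨆ k : ℕ, H K (k * 2 ^ ex i) * F i * ⊤

/-- `S = ⋃_{i ∈ Z} S_i`, where `S_i = [2^i - i - ⌊log i⌋, 2^i - ⌊log i⌋ - 1]`. -/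
def S (Z : Set ℕ) : Set ℕ :=
  ⋃ i ∈ Z, Set.Icc (2 ^ i - i - Nat.log 2 i) (2 ^ i - Nat.log 2 i - 1)

/-- The required properties of the spaces `U(2^n)` and `V(2^n)`, which are denoted here by `U n`
and `V n`. Products of subspaces are the spans of the products of their elements. -/
structure IsUVSystem (Z : Set ℕ) (F U V : ℕ → Submodule K (A K)) : Prop where
  U_le : ∀ n, U n ≤ H K (2 ^ n)
  V_le : ∀ n, V n ≤ H K (2 ^ n)
  finrank_of_notMem : ∀ n, 0 < n → n ∉ S Z → Module.finrank K (V n) = 2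
  finrank_of_mem : ∀ i ∈ Z, ∀ j, j ≤ i - 1 →
    Module.finrank K (V (2 ^ i - i - Nat.log 2 i + j)) = 2 ^ 2 ^ j
  spanned : ∀ n, 0 < n → ∃ s ⊆ M K (2 ^ n), V n = Submodule.span K s
  F_le : ∀ i ∈ Z, F i ≤ U (ex i)
  disjoint : ∀ n, 0 < n → V n ⊓ U n = ⊥
  sup_eq : ∀ n, 0 < n → V n ⊔ U n = H K (2 ^ n)
  ideal_like : ∀ n, 0 < n → H K (2 ^ n) * U n ⊔ U n * H K (2 ^ n) ≤ U (n + 1)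
  V_succ_le : ∀ n, 0 < n → V (n + 1) ≤ V n * V n
  monomials : ∀ n, 0 < n → n ∉ S Z → ∃ m₁ ∈ M K (2 ^ n), ∃ m₂ ∈ M K (2 ^ n),
    m₁ ∈ V n ∧ m₂ ∈ V n ∧ V n = Submodule.span K {m₁, m₂} ∧
      ∀ h ∈ H K (2 ^ n), m₂ * h ∈ U (n + 1)

/-- All the choices on which the construction of `E` rests. -/
structure IsConstruction (Z : Set ℕ) (f : ℕ → A K) (F U V : ℕ → Submodule K (A K)) : Prop where
  enumeration : IsSparseEnumeration Z f
  capturing : IsCapturing Z f F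
  system : IsUVSystem Z F U V

/-- The homogeneous component `E(n)`, for `n ≥ 1`: the `r ∈ H(n)` such that, if
`2^m ≤ n < 2^(m+1)`, then `H(j) r H(k) ⊆ U(2^(m+1)) H(2^(m+1)) + H(2^(m+1)) U(2^(m+1))` for all
`j, k ≥ 0` with `j + n + k = 2^(m+2)`. -/
def Ecomp (U : ℕ → Submodule K (A K)) (n : ℕ) : Submodule K (A K) where
  carrier := {r | r ∈ H K n ∧ ∀ m, 2 ^ m ≤ n → n < 2 ^ (m + 1) →
    ∀ j k, j + n + k = 2 ^ (m + 2) → ∀ a ∈ H K j, ∀ b ∈ H K k,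
      a * r * b ∈ U (m + 1) * H K (2 ^ (m + 1)) ⊔ H K (2 ^ (m + 1)) * U (m + 1)}
  add_mem' := by
    rintro r s ⟨hr, hr'⟩ ⟨hs, hs'⟩
    refine ⟨add_mem hr hs, fun m h₁ h₂ j k h a ha b hb => ?_⟩
    rw [mul_add, add_mul]
    exact add_mem (hr' m h₁ h₂ j k h a ha b hb) (hs' m h₁ h₂ j k h a ha b hb)
  zero_mem' := by
    refine ⟨zero_mem _, fun m _ _ j k _ a _ b _ => ?_⟩
    rw [mul_zero, zero_mul]
    exact zero_mem _
  smul_mem' := by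
    rintro c r ⟨hr, hr'⟩
    refine ⟨Submodule.smul_mem _ c hr, fun m h₁ h₂ j k h a ha b hb => ?_⟩
    rw [mul_smul_comm, smul_mul_assoc]
    exact Submodule.smul_mem _ c (hr' m h₁ h₂ j k h a ha b hb)

/-- `E = E(1) + E(2) + ...`. -/
def E (U : ℕ → Submodule K (A K)) : Submodule K (A K) := ⨆ (n : ℕ) (_ : 1 ≤ n), Ecomp U n

/-- `powSucc a n` is the power `a^(n+1)` in a ring that need not have a unit. -/
def powSucc {R : Type*} [Mul R] (a : R) : ℕ → R
  | 0 => a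
  | n + 1 => powSucc a n * a

/-- A possibly non-unital ring is nil if each of its elements is nilpotent. -/
def IsNilRing (R : Type*) [NonUnitalRing R] : Prop := ∀ a : R, ∃ n : ℕ, powSucc a n = 0

section Ideals

variable {R : Type*} [NonUnitalRing R] [Module K R]

/-- A two-sided ideal of an algebra `R` that need not have a unit: a `K`-subspace that absorbs
multiplication by elements of `R` on both sides. -/
structure AlgIdeal (K R : Type*) [Field K] [NonUnitalRing R] [Module K R]
    extends Submodule K R where
  mul_mem_left : ∀ a x : R, x ∈ carrier → a * x ∈ carrier
  mul_mem_right : ∀ x a : R, x ∈ carrier → x * a ∈ carrier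

/-- The quotient algebra `R / I`. -/
abbrev AlgIdeal.Quotient (I : AlgIdeal K R) : Type _ := R ⧸ I.toSubmodule

/-- Multiplication of `R / I`, with `[a] * [b] = [a * b]`. -/
instance AlgIdeal.quotientMul (I : AlgIdeal K R) : Mul I.Quotient where
  mul := Quotient.map₂ (· * ·) (by
    intro a a' ha b b' hb
    have ha' : a - a' ∈ I.toSubmodule := (Submodule.quotientRel_def _).1 ha
    have hb' : b - b' ∈ I.toSubmodule := (Submodule.quotientRel_def _).1 hb
    refine (Submodule.quotientRel_def _).2 ?_
    have h : a * b - a' * b' = (a - a') * b + a' * (b - b') := by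
      rw [sub_mul, mul_sub, sub_add_sub_cancel]
    rw [h]
    exact add_mem (I.mul_mem_right _ _ ha') (I.mul_mem_left _ _ hb'))

theorem AlgIdeal.mk_mul (I : AlgIdeal K R) (a b : R) :
    (Submodule.Quotient.mk (a * b) : I.Quotient) =
      (Submodule.Quotient.mk a : I.Quotient) * (Submodule.Quotient.mk b : I.Quotient) := rfl

/-- The ring structure (without unit) of `R / I`, on the additive group of the quotient space. -/
instance AlgIdeal.quotientRing (I : AlgIdeal K R) : NonUnitalRing I.Quotient where
  left_distrib := by
    rintro ⟨a⟩ ⟨b⟩ ⟨c⟩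
    exact congrArg (Submodule.Quotient.mk (p := I.toSubmodule)) (mul_add a b c)
  right_distrib := by
    rintro ⟨a⟩ ⟨b⟩ ⟨c⟩
    exact congrArg (Submodule.Quotient.mk (p := I.toSubmodule)) (add_mul a b c)
  zero_mul := by
    rintro ⟨a⟩
    exact congrArg (Submodule.Quotient.mk (p := I.toSubmodule)) (zero_mul a)
  mul_zero := by
    rintro ⟨a⟩
    exact congrArg (Submodule.Quotient.mk (p := I.toSubmodule)) (mul_zero a)
  mul_assoc := by
    rintro ⟨a⟩ ⟨b⟩ ⟨c⟩
    exact congrArg (Submodule.Quotient.mk (p := I.toSubmodule)) (mul_assoc a b c)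

end Ideals

end

end NilConstruction

namespace NilConstruction

noncomputable section

variable {K : Type*} [Field K]

/-! Think of `U n` as the part of degree `2^n` that is to die. It propagates up the dyadic tree: a
factor in `U` on a dyadic block puts the product over any larger dyadic block into the larger `U`.
`E` consists of the elements that cause such a factor wherever they are placed in a word of suitable
length.

Ideal: multiplication by a letter only matters when the degree reaches the next power of two.
`IsAbsorbed.succ` shows that absorption survives the change of scale, because an element at most a
quarter as long as the word lies in the first half, the second half or the middle two quarters.

Nil: every homogeneous component of a multiple of `f_i^(10 w_i)` contains `F_i ≤ U (ex i)` at a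
dyadically aligned position, so it is absorbed (`aligned_le`, `pow_mem_E`).

Infinite dimension: `V * V` meets `U H + H U` trivially (`mul_inf_eq_bot`) and `V` is nonzero, so
`E` misses part of each degree `2^m`; `E` is graded, so these degrees give independent classes.

Existence: reading `f^n` letter by letter is a finite-state process whose states are pending
suffixes of monomials of `f`. The prefixes of length `W` therefore lie in a space of dimension
linear in `W` (`exists_capturing`), which gives `F_i`. The pairs `U n`, `V n` are built by
recursion, with `V n` spanned by words: two words outside `S`, squaring inside a block until there
is room to put `F_i` into `U` and still keep two words (`exists_stage_succ`). -/

/-! ### Monomial basis, grading and products of splittings -/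

theorem monomial_nil : monomial K [] = 1 := by simp [monomial]

theorem monomial_append (v w : List (Fin 2)) :
    monomial K (v ++ w) = monomial K v * monomial K w := by
  simp [monomial]

/-- The basis of `A` consisting of the monomials. -/
def wordBasis (K : Type*) [Field K] : Module.Basis (List (Fin 2)) K (A K) :=
  (FreeAlgebra.basisFreeMonoid K (Fin 2)).reindex FreeMonoid.toList

theorem wordBasis_apply (w : List (Fin 2)) : wordBasis K w = monomial K w := by
  simp only [wordBasis, Module.Basis.reindex_apply, FreeAlgebra.basisFreeMonoid,
    Module.Basis.map_apply, Finsupp.coe_basisSingleOne]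
  change FreeAlgebra.equivMonoidAlgebraFreeMonoid.symm
    (MonoidAlgebra.single (FreeMonoid.toList.symm w) 1) = _
  change MonoidAlgebra.lift _ _ _ _ _ = _
  rw [MonoidAlgebra.lift_single, one_smul, FreeMonoid.lift_apply]
  rfl

theorem linearIndependent_monomial : LinearIndependent K (monomial K) := by
  have h := (wordBasis K).linearIndependent
  rwa [funext (wordBasis_apply (K := K))] at h

theorem span_range_monomial : Submodule.span K (Set.range (monomial K)) = ⊤ := by
  have h := (wordBasis K).span_eq
  rwa [funext (wordBasis_apply (K := K))] at h

theorem M_eq_image (n : ℕ) : M K n = monomial K '' {w | w.length = n} := rfl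

theorem monomial_mem_H (w : List (Fin 2)) : monomial K w ∈ H K w.length :=
  Submodule.subset_span ⟨w, rfl, rfl⟩

theorem H_induction {n : ℕ} {p : ∀ x, x ∈ H K n → Prop}
    (mon : ∀ (w : List (Fin 2)) (hw : w.length = n),
      p (monomial K w) (Submodule.subset_span ⟨w, hw, rfl⟩))
    (zero : p 0 (zero_mem _))
    (add : ∀ x y hx hy, p x hx → p y hy → p (x + y) (add_mem hx hy))
    (smul : ∀ (c : K) x hx, p x hx → p (c • x) (Submodule.smul_mem _ c hx))
    {x : A K} (hx : x ∈ H K n) : p x hx := by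
  refine Submodule.span_induction ?_ zero add smul hx
  rintro _ ⟨w, hw, rfl⟩
  exact mon w hw

theorem A_induction {p : A K → Prop} (x : A K)
    (mon : ∀ w : List (Fin 2), p (monomial K w)) (zero : p 0)
    (add : ∀ x y, p x → p y → p (x + y)) (smul : ∀ (c : K) x, p x → p (c • x)) : p x := by
  have hx : x ∈ Submodule.span K (Set.range (monomial K)) := by
    rw [span_range_monomial]; trivial
  refine Submodule.span_induction ?_ zero (fun x y _ _ => add x y) (fun c x _ => smul c x) hx
  rintro _ ⟨w, rfl⟩
  exact mon w

theorem H_mul (a b : ℕ) : H K a * H K b = H K (a + b) := by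
  rw [H, H, H, Submodule.span_mul_span]
  congr 1
  ext x
  constructor
  · rintro ⟨_, ⟨v, hv, rfl⟩, _, ⟨w, hw, rfl⟩, rfl⟩
    exact ⟨v ++ w, by simp [hv, hw], monomial_append v w⟩
  · rintro ⟨w, hw, rfl⟩
    refine ⟨_, ⟨w.take a, by simp [hw], rfl⟩, _, ⟨w.drop a, by simp [hw], rfl⟩, ?_⟩
    simp only [← monomial_append, List.take_append_drop]

theorem mul_mem_H {a b : ℕ} {x y : A K} (hx : x ∈ H K a) (hy : y ∈ H K b) :
    x * y ∈ H K (a + b) :=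
  H_mul (K := K) a b ▸ Submodule.mul_mem_mul hx hy

theorem one_mem_H : (1 : A K) ∈ H K 0 :=
  monomial_nil (K := K) ▸ monomial_mem_H []

instance finiteDimensional_H (n : ℕ) : FiniteDimensional K (H K n) :=
  FiniteDimensional.span_of_finite K ((List.finite_length_eq (Fin 2) n).image (monomial K))

/-- The homogeneous component of degree `n`. -/
def component (n : ℕ) : A K →ₗ[K] A K :=
  (wordBasis K).constr K fun w => if w.length = n then monomial K w else 0

theorem component_monomial (n : ℕ) (w : List (Fin 2)) :
    component n (monomial K w) = if w.length = n then monomial K w else 0 := by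
  rw [component, ← wordBasis_apply, Module.Basis.constr_basis, wordBasis_apply]

theorem component_mem (n : ℕ) (x : A K) : component n x ∈ H K n := by
  induction x using A_induction with
  | mon w =>
    rw [component_monomial]
    split_ifs with h
    · exact h ▸ monomial_mem_H w
    · exact zero_mem _
  | zero => rw [map_zero]; exact zero_mem _
  | add x y hx hy => rw [map_add]; exact add_mem hx hy
  | smul c x hx => rw [map_smul]; exact Submodule.smul_mem _ c hx

theorem component_of_mem {n : ℕ} {x : A K} (hx : x ∈ H K n) : component n x = x := by
  induction hx using H_induction with
  | mon w hw => rw [component_monomial, if_pos hw]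
  | zero => exact map_zero _
  | add x y _ _ hx hy => rw [map_add, hx, hy]
  | smul c x _ hx => rw [map_smul, hx]

theorem component_of_mem_ne {m n : ℕ} (hmn : m ≠ n) {x : A K} (hx : x ∈ H K m) :
    component n x = 0 := by
  induction hx using H_induction with
  | mon w hw => rw [component_monomial, if_neg (by rwa [hw])]
  | zero => exact map_zero _
  | add x y _ _ hx hy => rw [map_add, hx, hy, add_zero]
  | smul c x _ hx => rw [map_smul, hx, smul_zero]

theorem component_mul_mul {j k : ℕ} (n : ℕ) {a b : A K} (ha : a ∈ H K j) (hb : b ∈ H K k)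
    (x : A K) : component (j + n + k) (a * x * b) = a * component n x * b := by
  induction x using A_induction with
  | mon w =>
    have h : a * monomial K w * b ∈ H K (j + w.length + k) :=
      mul_mem_H (mul_mem_H ha (monomial_mem_H w)) hb
    rw [component_monomial]
    split_ifs with hw
    · subst hw
      exact component_of_mem h
    · rw [component_of_mem_ne (by omega) h, mul_zero, zero_mul]
  | zero => simp
  | add x y hx hy => simp [mul_add, add_mul, hx, hy]
  | smul c x hx => simp [hx]

theorem exists_sum_component (x : A K) : ∃ s : Finset ℕ, x = ∑ n ∈ s, component n x := by
  classical
  -- Allowing every larger index set makes the claim additive: two elements can share one set.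
  suffices h : ∃ N, ∀ s : Finset ℕ, Finset.range N ⊆ s → x = ∑ n ∈ s, component n x by
    obtain ⟨N, hN⟩ := h
    exact ⟨_, hN _ subset_rfl⟩
  induction x using A_induction with
  | mon w =>
    refine ⟨w.length + 1, fun s hs => ?_⟩
    simp only [component_monomial]
    rw [Finset.sum_ite_eq, if_pos (hs (by simp))]
  | zero => exact ⟨0, by simp⟩
  | add x y hx hy =>
    obtain ⟨N, hN⟩ := hx
    obtain ⟨N', hN'⟩ := hy
    refine ⟨max N N', fun s hs => ?_⟩
    simp only [map_add, Finset.sum_add_distrib]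
    rw [← hN s ((Finset.range_mono (le_max_left _ _)).trans hs),
      ← hN' s ((Finset.range_mono (le_max_right _ _)).trans hs)]
  | smul c x hx =>
    obtain ⟨N, hN⟩ := hx
    refine ⟨N, fun s hs => ?_⟩
    simp only [map_smul, ← Finset.smul_sum]
    rw [← hN s hs]

/-- The linear map with `x * y ↦ p x * q y` for `x` homogeneous of degree `a`. -/
def splitMap (a : ℕ) (p q : A K →ₗ[K] A K) : A K →ₗ[K] A K :=
  (wordBasis K).constr K fun w => p (monomial K (w.take a)) * q (monomial K (w.drop a))

theorem splitMap_mul {a : ℕ} (p q : A K →ₗ[K] A K) {x : A K} (hx : x ∈ H K a) (y : A K) :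
    splitMap a p q (x * y) = p x * q y := by
  induction hx using H_induction with
  | mon v hv =>
    induction y using A_induction with
    | mon w =>
      rw [← monomial_append, splitMap, ← wordBasis_apply, Module.Basis.constr_basis]
      subst hv
      simp
    | zero => simp
    | add x y hx hy => simp [mul_add, hx, hy]
    | smul c x hx => simp [hx]
  | zero => simp
  | add x y _ _ hx hy => simp [add_mul, hx, hy]
  | smul c x _ hx => simp [hx]

theorem exists_projection {U V : Submodule K (A K)} (h : V ⊓ U = ⊥) :
    ∃ p : A K →ₗ[K] A K, (∀ x ∈ V, p x = x) ∧ ∀ x ∈ U, p x = 0 := by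
  obtain ⟨W, hVW, hW⟩ := (disjoint_iff.2 h).exists_isCompl
  exact ⟨W.projection U hW, fun x hx => Submodule.projection_apply_of_mem_left hW (hVW hx),
    fun x hx => (Submodule.projection_apply_eq_zero_iff hW).2 hx⟩

/-- With `p` the identity on `V` and zero on `U`, the map `p ⊗ p`, realised by `splitMap`, fixes `V
* V` and kills both summands on the other side. -/
theorem mul_inf_eq_bot {n k : ℕ} {U V : Submodule K (A K)} (hU : U ≤ H K n) (hV : V ≤ H K n)
    (h : V ⊓ U = ⊥) : V * V ⊓ (H K n * U ⊔ U * H K k) = ⊥ := by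
  obtain ⟨p, hpV, hpU⟩ := exists_projection h
  have h₁ : ∀ x ∈ V * V, splitMap n p p x = x := fun x hx => by
    induction hx using Submodule.mul_induction_on' with
    | mem_mul_mem x hx y hy => rw [splitMap_mul p p (hV hx), hpV x hx, hpV y hy]
    | add x _ y _ hx hy => rw [map_add, hx, hy]
  have h₂ : H K n * U ⊔ U * H K k ≤ LinearMap.ker (splitMap n p p) := by
    refine sup_le (Submodule.mul_le.2 fun x hx y hy => ?_)
      (Submodule.mul_le.2 fun x hx y hy => ?_)
    · rw [LinearMap.mem_ker, splitMap_mul p p hx, hpU y hy, mul_zero]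
    · rw [LinearMap.mem_ker, splitMap_mul p p (hU hx), hpU x hx, zero_mul]
  refine (Submodule.eq_bot_iff _).2 fun x hx => ?_
  rw [← h₁ x hx.1]
  exact h₂ hx.2

theorem mem_Abar_of_mem_H {n : ℕ} (hn : 1 ≤ n) {x : A K} (hx : x ∈ H K n) : x ∈ Abar K := by
  change FreeAlgebra.algebraMapInv x = 0
  induction hx using H_induction with
  | mon w hw =>
    cases w with
    | nil => simp at hw; omega
    | cons i w => simp [monomial, FreeAlgebra.algebraMapInv]
  | zero => exact map_zero _
  | add x y _ _ hx hy => rw [map_add, hx, hy, add_zero]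
  | smul c x _ hx => rw [map_smul, hx, smul_zero]

theorem component_zero_of_mem_Abar {x : A K} (hx : x ∈ Abar K) : component 0 x = 0 := by
  have h : ∀ y : A K, component 0 y = FreeAlgebra.algebraMapInv y • 1 := fun y => by
    induction y using A_induction with
    | mon w =>
      cases w with
      | nil => rw [component_monomial]; simp [monomial_nil]
      | cons i w => rw [component_monomial]; simp [monomial, FreeAlgebra.algebraMapInv]
    | zero => simp
    | add x y hx hy => simp [hx, hy, add_smul]
    | smul c x hx => simp [hx, mul_smul]
  rw [h, show FreeAlgebra.algebraMapInv x = 0 from hx, zero_smul]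

theorem H_zero : H K 0 = 1 := by
  rw [Submodule.one_eq_span, H]
  congr 1
  ext x
  simp only [M, List.length_eq_zero_iff, exists_eq_left, monomial_nil, Set.mem_singleton_iff]
  exact eq_comm

/-! ### `E` is a graded two-sided ideal -/

/-- The space `U(2^n) H(2^n) + H(2^n) U(2^n)`. -/
def sideSum (U : ℕ → Submodule K (A K)) (n : ℕ) : Submodule K (A K) :=
  U n * H K (2 ^ n) ⊔ H K (2 ^ n) * U n

/-- Each product `H(j) R H(k)` of total degree `2^(m+2)` lies in
`U(2^(m+1)) H(2^(m+1)) + H(2^(m+1)) U(2^(m+1))`, where `R` is thought of in degree `n`. -/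
def IsAbsorbed (U : ℕ → Submodule K (A K)) (m n : ℕ) (R : Submodule K (A K)) : Prop :=
  ∀ j k, j + n + k = 2 ^ (m + 2) → H K j * R * H K k ≤ sideSum U (m + 1)

section Ideal

variable {U : ℕ → Submodule K (A K)}

/-- In `IsAbsorbed` the scale `m` is independent of the degree `n`, so the two can be raised
separately. -/
theorem mem_Ecomp_iff {m n : ℕ} (h₁ : 2 ^ m ≤ n) (h₂ : n < 2 ^ (m + 1)) {r : A K} :
    r ∈ Ecomp U n ↔ r ∈ H K n ∧ IsAbsorbed U m n (Submodule.span K {r}) := by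
  constructor
  · rintro ⟨hr, h⟩
    refine ⟨hr, fun j k hjk => ?_⟩
    rw [Submodule.mul_le]
    intro x hx b hb
    induction hx using Submodule.mul_induction_on' with
    | mem_mul_mem a ha y hy =>
      obtain ⟨c, rfl⟩ := Submodule.mem_span_singleton.1 hy
      rw [mul_smul_comm, smul_mul_assoc]
      exact Submodule.smul_mem _ c (h m h₁ h₂ j k hjk a ha b hb)
    | add x _ y _ hx hy => rw [add_mul]; exact add_mem hx hy
  · rintro ⟨hr, h⟩
    refine ⟨hr, fun m' h₁' h₂' j k hjk a ha b hb => ?_⟩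
    obtain rfl : m' = m := by
      have h₃ := (Nat.pow_lt_pow_iff_right (by norm_num : 1 < 2)).1 (h₁'.trans_lt h₂)
      have h₄ := (Nat.pow_lt_pow_iff_right (by norm_num : 1 < 2)).1 (h₁.trans_lt h₂')
      omega
    exact h j k hjk (Submodule.mul_mem_mul
      (Submodule.mul_mem_mul ha (Submodule.mem_span_singleton_self r)) hb)

theorem IsAbsorbed.mul_right {m n : ℕ} {R : Submodule K (A K)} (h : IsAbsorbed U m n R) :
    IsAbsorbed U m (n + 1) (R * H K 1) := fun j k hjk => by
  rw [mul_assoc, mul_assoc, H_mul, ← mul_assoc]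
  exact h j (1 + k) (by omega)

theorem IsAbsorbed.mul_left {m n : ℕ} {R : Submodule K (A K)} (h : IsAbsorbed U m n R) :
    IsAbsorbed U m (n + 1) (H K 1 * R) := fun j k hjk => by
  rw [← mul_assoc, H_mul]
  exact h (j + 1) k (by omega)

theorem IsAbsorbed.mono {m n : ℕ} {R R' : Submodule K (A K)} (h : IsAbsorbed U m n R)
    (hR : R' ≤ R) : IsAbsorbed U m n R' := fun j k hjk =>
  (mul_le_mul' (mul_le_mul' le_rfl hR) le_rfl).trans (h j k hjk)

theorem sideSum_le (hU : ∀ n, 0 < n → H K (2 ^ n) * U n ⊔ U n * H K (2 ^ n) ≤ U (n + 1))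
    {n : ℕ} (hn : 0 < n) : sideSum U n ≤ U (n + 1) :=
  sup_le (le_sup_right.trans (hU n hn)) (le_sup_left.trans (hU n hn))

/-- Cut a word of length `2^(m+3)` into four quarters of length `2^(m+1)`. As `n` is at most one
quarter, `R` lies in the first half, in the second half, or in the middle two quarters. In the first
two cases that half falls into `sideSum U (m + 1) ≤ U (m + 2)`. In the last, a `U`-factor appears in
the second or third quarter and is completed to its half by the adjacent outer quarter. -/
theorem IsAbsorbed.succ (hU : ∀ n, 0 < n → H K (2 ^ n) * U n ⊔ U n * H K (2 ^ n) ≤ U (n + 1))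
    {m n : ℕ} {R : Submodule K (A K)} (hn : n ≤ 2 ^ (m + 1)) (h : IsAbsorbed U m n R) :
    IsAbsorbed U (m + 1) n R := by
  intro j k hjk
  have hQ := sideSum_le hU (Nat.succ_pos m)
  have e₂ : 2 ^ (m + 2) = 2 * 2 ^ (m + 1) := pow_succ' 2 (m + 1)
  have e₃ : 2 ^ (m + 1 + 2) = 4 * 2 ^ (m + 1) := by rw [pow_add 2 (m + 1) 2]; ring
  by_cases h₁ : j + n ≤ 2 ^ (m + 2)
  · obtain ⟨k', rfl⟩ : ∃ k', k = k' + 2 ^ (m + 2) := ⟨k - 2 ^ (m + 2), by omega⟩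
    rw [← H_mul, ← mul_assoc]
    exact (mul_le_mul' ((h j k' (by omega)).trans hQ) le_rfl).trans le_sup_left
  by_cases h₂ : 2 ^ (m + 2) ≤ j
  · obtain ⟨j', rfl⟩ : ∃ j', j = 2 ^ (m + 2) + j' := ⟨j - 2 ^ (m + 2), by omega⟩
    rw [← H_mul, mul_assoc, mul_assoc, ← mul_assoc (H K j')]
    exact (mul_le_mul' le_rfl ((h j' k (by omega)).trans hQ)).trans le_sup_right
  obtain ⟨j', rfl⟩ : ∃ j', j = 2 ^ (m + 1) + j' := ⟨j - 2 ^ (m + 1), by omega⟩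
  obtain ⟨k', rfl⟩ : ∃ k', k = k' + 2 ^ (m + 1) := ⟨k - 2 ^ (m + 1), by omega⟩
  rw [← H_mul, ← H_mul]
  have e : H K (2 ^ (m + 1)) * H K j' * R * (H K k' * H K (2 ^ (m + 1))) =
      H K (2 ^ (m + 1)) * (H K j' * R * H K k') * H K (2 ^ (m + 1)) := by
    simp only [mul_assoc]
  rw [e]
  refine (mul_le_mul' (mul_le_mul' le_rfl (h j' k' (by omega))) le_rfl).trans ?_
  have hH : H K (2 ^ (m + 1)) * H K (2 ^ (m + 1)) = H K (2 ^ (m + 1 + 1)) := by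
    rw [H_mul]; congr 1; omega
  rw [sideSum, Submodule.mul_sup, Submodule.sup_mul]
  refine sup_le (le_sup_of_le_left ?_) (le_sup_of_le_right ?_)
  · rw [← mul_assoc, mul_assoc, hH]
    exact mul_le_mul' (le_sup_left.trans (hU (m + 1) (Nat.succ_pos m))) le_rfl
  · rw [← mul_assoc, hH, mul_assoc]
    exact mul_le_mul' le_rfl (le_sup_right.trans (hU (m + 1) (Nat.succ_pos m)))

/-- The scale changes only if `n + 1` is a power of two; `IsAbsorbed.succ` covers that case. -/
theorem mem_Ecomp_succ (hU : ∀ n, 0 < n → H K (2 ^ n) * U n ⊔ U n * H K (2 ^ n) ≤ U (n + 1))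
    {n : ℕ} (hn : 1 ≤ n) {r s : A K} (hr : r ∈ Ecomp U n) (hs : s ∈ H K (n + 1))
    (h : ∀ m, IsAbsorbed U m n (Submodule.span K {r}) →
      IsAbsorbed U m (n + 1) (Submodule.span K {s})) : s ∈ Ecomp U (n + 1) := by
  have h₁ : 2 ^ Nat.log 2 n ≤ n := Nat.pow_log_le_self 2 (by omega)
  have h₂ : n < 2 ^ (Nat.log 2 n + 1) := Nat.lt_pow_succ_log_self (by norm_num) n
  have hr' := ((mem_Ecomp_iff h₁ h₂).1 hr).2
  rcases Nat.lt_or_ge (n + 1) (2 ^ (Nat.log 2 n + 1)) with h₃ | h₃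
  · exact (mem_Ecomp_iff (by omega) h₃).2 ⟨hs, h _ hr'⟩
  · have h₄ : 2 ^ (Nat.log 2 n + 1 + 1) = 2 * 2 ^ (Nat.log 2 n + 1) := pow_succ' _ _
    exact (mem_Ecomp_iff h₃ (by omega)).2 ⟨hs, h _ (hr'.succ hU h₂.le)⟩

theorem Ecomp_mul_right (hU : ∀ n, 0 < n → H K (2 ^ n) * U n ⊔ U n * H K (2 ^ n) ≤ U (n + 1))
    {n : ℕ} (hn : 1 ≤ n) {r x : A K} (hr : r ∈ Ecomp U n) (hx : x ∈ H K 1) :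
    r * x ∈ Ecomp U (n + 1) := by
  refine mem_Ecomp_succ hU hn hr (mul_mem_H hr.1 hx) fun m h => h.mul_right.mono ?_
  rw [Submodule.span_singleton_le_iff_mem]
  exact Submodule.mul_mem_mul (Submodule.mem_span_singleton_self r) hx

theorem Ecomp_mul_left (hU : ∀ n, 0 < n → H K (2 ^ n) * U n ⊔ U n * H K (2 ^ n) ≤ U (n + 1))
    {n : ℕ} (hn : 1 ≤ n) {r x : A K} (hr : r ∈ Ecomp U n) (hx : x ∈ H K 1) :
    x * r ∈ Ecomp U (n + 1) := by
  refine mem_Ecomp_succ hU hn hr (add_comm 1 n ▸ mul_mem_H hx hr.1) fun m h =>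
    h.mul_left.mono ?_
  rw [Submodule.span_singleton_le_iff_mem]
  exact Submodule.mul_mem_mul hx (Submodule.mem_span_singleton_self r)

theorem Ecomp_le_E {n : ℕ} (hn : 1 ≤ n) : Ecomp U n ≤ E U :=
  le_iSup₂_of_le n hn le_rfl

theorem E_induction {p : A K → Prop} (mem : ∀ n, 1 ≤ n → ∀ x ∈ Ecomp U n, p x) (zero : p 0)
    (add : ∀ x y, p x → p y → p (x + y)) {x : A K} (hx : x ∈ E U) : p x := by
  refine Submodule.iSup_induction _ (motive := p) hx (fun n y hy => ?_) zero add
  by_cases hn : 1 ≤ n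
  · rw [iSup_pos hn] at hy
    exact mem n hn y hy
  · rw [iSup_neg hn, Submodule.mem_bot] at hy
    rwa [hy]

theorem component_mem_Ecomp {n : ℕ} {x : A K} (hx : x ∈ E U) : component n x ∈ Ecomp U n := by
  refine E_induction (p := fun x => component n x ∈ Ecomp U n) (fun m _ x hx => ?_) ?_ ?_ hx
  · by_cases h : m = n
    · subst h
      rwa [component_of_mem hx.1]
    · rw [component_of_mem_ne h hx.1]
      exact zero_mem _
  · rw [map_zero]; exact zero_mem _
  · intro x y hx hy
    rw [map_add]
    exact add_mem hx hy

theorem E_le_Abar {x : A K} (hx : x ∈ E U) : x ∈ Abar K :=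
  E_induction (p := fun x => x ∈ Abar K) (fun _ hn _ hx => mem_Abar_of_mem_H hn hx.1)
    (zero_mem _) (fun _ _ => add_mem) hx

theorem E_mul_right (hU : ∀ n, 0 < n → H K (2 ^ n) * U n ⊔ U n * H K (2 ^ n) ≤ U (n + 1))
    {r : A K} (hr : r ∈ E U) (x : A K) : r * x ∈ E U := by
  induction x using A_induction with
  | mon w =>
    induction w generalizing r with
    | nil => rwa [monomial_nil, mul_one]
    | cons i w ih =>
      rw [← List.singleton_append, monomial_append, ← mul_assoc]
      refine ih (E_induction (p := fun r => r * monomial K [i] ∈ E U) (fun n hn x hx => ?_)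
        ?_ ?_ hr)
      · exact Ecomp_le_E (by omega) (Ecomp_mul_right hU hn hx (monomial_mem_H [i]))
      · rw [zero_mul]; exact zero_mem _
      · intro x y hx hy
        rw [add_mul]
        exact add_mem hx hy
  | zero => rw [mul_zero]; exact zero_mem _
  | add x y hx hy => rw [mul_add]; exact add_mem hx hy
  | smul c x hx => rw [mul_smul_comm]; exact Submodule.smul_mem _ c hx

theorem E_mul_left (hU : ∀ n, 0 < n → H K (2 ^ n) * U n ⊔ U n * H K (2 ^ n) ≤ U (n + 1))
    {r : A K} (hr : r ∈ E U) (x : A K) : x * r ∈ E U := by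
  induction x using A_induction with
  | mon w =>
    induction w with
    | nil => rwa [monomial_nil, one_mul]
    | cons i w ih =>
      rw [← List.singleton_append, monomial_append, mul_assoc]
      refine E_induction (p := fun r => monomial K [i] * r ∈ E U) (fun n hn x hx => ?_) ?_ ?_ ih
      · exact Ecomp_le_E (by omega) (Ecomp_mul_left hU hn hx (monomial_mem_H [i]))
      · rw [mul_zero]; exact zero_mem _
      · intro x y hx hy
        rw [mul_add]
        exact add_mem hx hy
  | zero => rw [zero_mul]; exact zero_mem _
  | add x y hx hy => rw [add_mul]; exact add_mem hx hy
  | smul c x hx => rw [smul_mul_assoc]; exact Submodule.smul_mem _ c hx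

/-! ### High powers lie in `E` -/

theorem component_mul_of_lt {j n : ℕ} (hn : n < j) {a : A K} (ha : a ∈ H K j) (x : A K) :
    component n (a * x) = 0 := by
  induction x using A_induction with
  | mon w => exact component_of_mem_ne (by omega) (mul_mem_H ha (monomial_mem_H w))
  | zero => simp
  | add x y hx hy => rw [mul_add, map_add, hx, hy, add_zero]
  | smul c x hx => rw [mul_smul_comm, map_smul, hx, smul_zero]

theorem component_mul_eq_zero {a b n : ℕ} {x y : A K} (hx : ∀ i < a, component i x = 0)
    (hy : ∀ i < b, component i y = 0) (hn : n < a + b) : component n (x * y) = 0 := by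
  obtain ⟨s, hs⟩ := exists_sum_component x
  obtain ⟨t, ht⟩ := exists_sum_component y
  rw [hs, ht, Finset.sum_mul_sum, map_sum]
  refine Finset.sum_eq_zero fun i _ => ?_
  rw [map_sum]
  refine Finset.sum_eq_zero fun j _ => ?_
  by_cases hi : i < a
  · rw [hx i hi, zero_mul, map_zero]
  by_cases hj : j < b
  · rw [hy j hj, mul_zero, map_zero]
  exact component_of_mem_ne (by omega) (mul_mem_H (component_mem i x) (component_mem j y))

theorem component_pow_eq_zero {f : A K} (hf : f ∈ Abar K) (N : ℕ) :
    ∀ n < N, component n (f ^ N) = 0 := by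
  induction N with
  | zero => intro n hn; omega
  | succ N ih =>
    intro n hn
    rw [pow_succ]
    refine component_mul_eq_zero ih (b := 1) (fun i hi => ?_) hn
    obtain rfl : i = 0 := by omega
    exact component_zero_of_mem_Abar hf

theorem component_mem_of_mem_iSup {W : ℕ} {F : Submodule K (A K)} (hF : F ≤ H K W) (n : ℕ)
    {x : A K} (hx : x ∈ ⨆ k : ℕ, H K (k * W) * F * ⊤) :
    component n x ∈ ⨆ (k : ℕ) (_ : k * W + W ≤ n), H K (k * W) * F * H K (n - (k * W + W)) := by
  refine Submodule.iSup_induction _ (motive := fun x => component n x ∈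
    ⨆ (k : ℕ) (_ : k * W + W ≤ n), H K (k * W) * F * H K (n - (k * W + W))) hx
    (fun k x hx => ?_) ?_ ?_
  · induction hx using Submodule.mul_induction_on' with
    | mem_mul_mem a ha y _ =>
      have ha' : a ∈ H K (k * W + W) := by
        rw [← H_mul]
        exact mul_le_mul' le_rfl hF ha
      by_cases hk : k * W + W ≤ n
      · refine Submodule.mem_iSup_of_mem k (Submodule.mem_iSup_of_mem hk ?_)
        have h := component_mul_mul (n - (k * W + W)) ha' one_mem_H y
        rw [mul_one, mul_one, show k * W + W + (n - (k * W + W)) + 0 = n by omega] at h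
        rw [h]
        exact Submodule.mul_mem_mul ha (component_mem _ _)
      · rw [component_mul_of_lt (by omega) ha']
        exact zero_mem _
    | add x _ y _ hx hy => rw [map_add]; exact add_mem hx hy
  · rw [map_zero]; exact zero_mem _
  · intro x y hx hy
    rw [map_add]
    exact add_mem hx hy

/-- Since `W` divides `2^n`, a block of length `W` starting at a multiple of `W` never straddles the
midpoint, so it lies in one half. -/
theorem aligned_le_sideSum {n W k l : ℕ} {F : Submodule K (A K)} (hW : W ∣ 2 ^ n)
    (h : ∀ k l, k * W + W + l = 2 ^ n → H K (k * W) * F * H K l ≤ U n)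
    (hkl : k * W + W + l = 2 ^ (n + 1)) : H K (k * W) * F * H K l ≤ sideSum U n := by
  obtain ⟨c, hc⟩ := hW
  have e : 2 ^ (n + 1) = 2 * 2 ^ n := pow_succ' _ _
  by_cases hk : k < c
  · have h₁ : (k + 1) * W ≤ c * W := Nat.mul_le_mul_right W hk
    obtain ⟨l', rfl⟩ : ∃ l', l = l' + 2 ^ n := ⟨l - 2 ^ n, by grind⟩
    rw [← H_mul, ← mul_assoc]
    exact (mul_le_mul' (h k l' (by omega)) le_rfl).trans le_sup_left
  · obtain ⟨k', rfl⟩ : ∃ k', k = c + k' := ⟨k - c, by omega⟩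
    have h₁ : (c + k') * W = 2 ^ n + k' * W := by rw [hc]; ring
    rw [h₁, ← H_mul, mul_assoc, mul_assoc, ← mul_assoc (H K (k' * W))]
    exact (mul_le_mul' le_rfl (h k' l (by omega))).trans le_sup_right

theorem aligned_le (hU : ∀ n, 0 < n → H K (2 ^ n) * U n ⊔ U n * H K (2 ^ n) ≤ U (n + 1))
    {e n : ℕ} (he : 0 < e) (hen : e ≤ n) {F : Submodule K (A K)} (hF : F ≤ U e) :
    ∀ k l, k * 2 ^ e + 2 ^ e + l = 2 ^ n → H K (k * 2 ^ e) * F * H K l ≤ U n := by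
  induction n, hen using Nat.le_induction with
  | base =>
    intro k l hkl
    have hpos : 0 < 2 ^ e := by positivity
    have h₁ : k * 2 ^ e = 0 := by omega
    obtain rfl : l = 0 := by omega
    rw [h₁, H_zero, one_mul, mul_one]
    exact hF
  | succ n hn ih =>
    intro k l hkl
    exact (aligned_le_sideSum (pow_dvd_pow 2 hn) ih hkl).trans (sideSum_le hU (by omega))

theorem pow_mem_E (hU : ∀ n, 0 < n → H K (2 ^ n) * U n ⊔ U n * H K (2 ^ n) ≤ U (n + 1))
    {e N : ℕ} (he : 0 < e) (hN : 2 ^ e ≤ N) {F : Submodule K (A K)} (hF : F ≤ U e)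
    (hFH : F ≤ H K (2 ^ e)) {f : A K} (hf : f ∈ Abar K)
    (hcap : ∀ g ∈ TwoSidedIdeal.span {f ^ N}, g ∈ ⨆ k : ℕ, H K (k * 2 ^ e) * F * ⊤) :
    f ^ N ∈ E U := by
  have hpos : 0 < 2 ^ e := by positivity
  obtain ⟨s, hs⟩ := exists_sum_component (f ^ N)
  rw [hs]
  refine Submodule.sum_mem _ fun n _ => ?_
  by_cases hn : n < N
  · rw [component_pow_eq_zero hf N n hn]
    exact zero_mem _
  refine Ecomp_le_E (by omega) ⟨component_mem _ _, fun m h₁ h₂ j k hjk a ha b hb => ?_⟩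
  rw [← component_mul_mul n ha hb, hjk]
  have hmem : a * f ^ N * b ∈ TwoSidedIdeal.span {f ^ N} :=
    TwoSidedIdeal.mul_mem_right _ _ _ (TwoSidedIdeal.mul_mem_left _ _ _
      (TwoSidedIdeal.subset_span rfl))
  -- Components of degree below `N` vanish, so `2^e ≤ N ≤ n < 2^(m+1)`.
  have hem : e ≤ m + 1 :=
    ((Nat.pow_lt_pow_iff_right (by norm_num : 1 < 2)).1 (by omega : 2 ^ e < 2 ^ (m + 1))).le
  have h := component_mem_of_mem_iSup hFH (2 ^ (m + 2)) (hcap _ hmem)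
  refine (iSup₂_le fun k hk => ?_ : _ ≤ sideSum U (m + 1)) h
  exact aligned_le_sideSum (pow_dvd_pow 2 hem) (aligned_le hU he hem hF)
    (Nat.add_sub_cancel' hk)

/-! ### The quotient: nilpotency and infinite dimension -/

/-- If all of `H(2^m)` were absorbed, then `H(2^(m+2))` would lie in `sideSum U (m + 1)`. A square
`v * v` with `0 ≠ v ∈ V (m + 1)` is nonzero because `A` is a domain, and it contradicts
`mul_inf_eq_bot`. -/
theorem exists_notMem_Ecomp {V : ℕ → Submodule K (A K)} {m : ℕ} (hU : U (m + 1) ≤ H K (2 ^ (m + 1)))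
    (hV : V (m + 1) ≤ H K (2 ^ (m + 1))) (hVU : V (m + 1) ⊓ U (m + 1) = ⊥)
    (hV₀ : V (m + 1) ≠ ⊥) : ∃ r ∈ H K (2 ^ m), r ∉ Ecomp U (2 ^ m) := by
  by_contra! h
  have hle : H K (2 ^ (m + 2)) ≤ sideSum U (m + 1) := by
    rw [show 2 ^ (m + 2) = 0 + 2 ^ m + 3 * 2 ^ m by rw [pow_add]; ring, ← H_mul, ← H_mul,
      Submodule.mul_le]
    intro x hx b hb
    induction hx using Submodule.mul_induction_on' with
    | mem_mul_mem a ha y hy =>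
      exact (h y hy).2 m le_rfl (Nat.pow_lt_pow_right (by norm_num) (by omega)) 0 (3 * 2 ^ m)
        (by rw [pow_add]; ring) a ha b hb
    | add x _ y _ hx hy => rw [add_mul]; exact add_mem hx hy
  obtain ⟨v, hv, hv₀⟩ := (Submodule.ne_bot_iff _).1 hV₀
  have hvv : v * v ∈ V (m + 1) * V (m + 1) := Submodule.mul_mem_mul hv hv
  have hvH : v * v ∈ H K (2 ^ (m + 2)) := by
    rw [show 2 ^ (m + 2) = 2 ^ (m + 1) + 2 ^ (m + 1) by ring]
    exact mul_mem_H (hV hv) (hV hv)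
  have hmem := Submodule.mem_inf.2 ⟨hvv, hle hvH⟩
  rw [sideSum, sup_comm, mul_inf_eq_bot hU hV hVU, Submodule.mem_bot] at hmem
  exact hv₀ (mul_self_eq_zero.1 hmem)

/-- The ideal `E` of `Ā`. -/
def idealE (hU : ∀ n, 0 < n → H K (2 ^ n) * U n ⊔ U n * H K (2 ^ n) ≤ U (n + 1)) :
    AlgIdeal K (Abar K) where
  toSubmodule := (E U).comap (NonUnitalSubalgebraClass.subtype (Abar K) : Abar K →ₗ[K] A K)
  mul_mem_left := fun a _ hx => E_mul_left hU hx (a : A K)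
  mul_mem_right := fun _ a hx => E_mul_right hU hx (a : A K)

theorem mem_idealE (hU : ∀ n, 0 < n → H K (2 ^ n) * U n ⊔ U n * H K (2 ^ n) ≤ U (n + 1))
    (a : Abar K) : a ∈ (idealE hU).toSubmodule ↔ (a : A K) ∈ E U := Iff.rfl

theorem coe_powSucc (a : Abar K) (n : ℕ) : ((powSucc a n : Abar K) : A K) = (a : A K) ^ (n + 1) := by
  induction n with
  | zero => simp [powSucc]
  | succ n ih => rw [powSucc, NonUnitalSubalgebra.coe_mul, ih, ← pow_succ]

theorem powSucc_mk {R : Type*} [NonUnitalRing R] [Module K R] (I : AlgIdeal K R) (a : R) (n : ℕ) :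
    powSucc (Submodule.Quotient.mk a : I.Quotient) n = Submodule.Quotient.mk (powSucc a n) := by
  induction n with
  | zero => rfl
  | succ n ih => rw [powSucc, ih, ← AlgIdeal.mk_mul, powSucc]

theorem isNilRing_quotient (hU : ∀ n, 0 < n → H K (2 ^ n) * U n ⊔ U n * H K (2 ^ n) ≤ U (n + 1))
    (h : ∀ f ∈ Abar K, ∃ N, f ^ (N + 1) ∈ E U) : IsNilRing (idealE hU).Quotient := by
  rintro ⟨a⟩
  obtain ⟨N, hN⟩ := h a a.2
  refine ⟨N, ?_⟩
  change powSucc (Submodule.Quotient.mk a : (idealE hU).Quotient) N = 0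
  rw [powSucc_mk, Submodule.Quotient.mk_eq_zero, mem_idealE,
    coe_powSucc]
  exact hN

/-- The chosen `r m` have distinct degrees and `E` is graded, so a relation modulo `E` can be tested
one component at a time. -/
theorem infinite_quotient (hU : ∀ n, 0 < n → H K (2 ^ n) * U n ⊔ U n * H K (2 ^ n) ≤ U (n + 1))
    (h : ∀ m, ∃ r ∈ H K (2 ^ m), r ∉ Ecomp U (2 ^ m)) :
    ¬ FiniteDimensional K (idealE hU).Quotient := by
  choose r hr hrE using h
  let v : ℕ → Abar K := fun m => ⟨r m, mem_Abar_of_mem_H Nat.one_le_two_pow (hr m)⟩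
  have hv : LinearIndependent K fun m => ((idealE hU).toSubmodule.mkQ (v m)) := by
    rw [linearIndependent_iff']
    intro s g hg i hi
    simp only [← map_smul, ← map_sum] at hg
    rw [Submodule.mkQ_apply, Submodule.Quotient.mk_eq_zero, mem_idealE] at hg
    have hg' : ∑ m ∈ s, g m • r m ∈ E U := by
      have e : ((∑ m ∈ s, g m • v m : Abar K) : A K) = ∑ m ∈ s, g m • r m := by
        simp [v]
      rwa [e] at hg
    have h₁ := component_mem_Ecomp (n := 2 ^ i) hg'
    have h₂ : component (2 ^ i) (∑ m ∈ s, g m • r m) = g i • r i := by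
      rw [map_sum, Finset.sum_eq_single i]
      · rw [map_smul, component_of_mem (hr i)]
      · intro m _ hm
        rw [map_smul, component_of_mem_ne _ (hr m), smul_zero]
        exact fun h => hm (Nat.pow_right_injective le_rfl h)
      · exact fun h => absurd hi h
    rw [h₂] at h₁
    by_contra hgi
    exact hrE i ((Submodule.smul_mem_iff _ hgi).1 h₁)
  intro hfin
  exact (hv.finite : Finite ℕ).false

end Ideal

/-! ### Prefixes of powers and the spaces `F_i` -/

/-- The words of length at most `d`. -/
def wordsLE : ℕ → Finset (List (Fin 2))
  | 0 => {[]}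
  | d + 1 => insert [] ((wordsLE d).image (List.cons 0) ∪ (wordsLE d).image (List.cons 1))

theorem mem_wordsLE {d : ℕ} {w : List (Fin 2)} : w ∈ wordsLE d ↔ w.length ≤ d := by
  induction d generalizing w with
  | zero => simp [wordsLE]
  | succ d ih =>
    cases w with
    | nil => simp [wordsLE]
    | cons i w => fin_cases i <;> simp [wordsLE, ih]

theorem card_wordsLE_lt (d : ℕ) : (wordsLE d).card < 2 ^ (d + 1) := by
  induction d with
  | zero => simp [wordsLE]
  | succ d ih =>
    have h₁ := Finset.card_insert_le []
      ((wordsLE d).image (List.cons 0) ∪ (wordsLE d).image (List.cons 1))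
    have h₂ := Finset.card_union_le ((wordsLE d).image (List.cons 0))
      ((wordsLE d).image (List.cons 1))
    have h₃ := Finset.card_image_le (s := wordsLE d) (f := List.cons 0)
    have h₄ := Finset.card_image_le (s := wordsLE d) (f := List.cons 1)
    have h₅ : 2 ^ (d + 1 + 1) = 2 * 2 ^ (d + 1) := pow_succ' _ _
    rw [wordsLE]
    omega

theorem mem_iSup_H_deg (f : A K) : f ∈ ⨆ (k : ℕ) (_ : k ≤ deg f), H K k := by
  have h : {d | f ∈ ⨆ (k : ℕ) (_ : k ≤ d), H K k}.Nonempty := by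
    obtain ⟨s, hs⟩ := exists_sum_component f
    refine ⟨s.sup id, ?_⟩
    change f ∈ ⨆ (k : ℕ) (_ : k ≤ s.sup id), H K k
    rw [hs]
    exact Submodule.sum_mem _ fun n hn => Submodule.mem_iSup_of_mem n
      (Submodule.mem_iSup_of_mem (Finset.le_sup (f := id) hn) (component_mem n _))
  exact Nat.sInf_mem h

theorem exists_eq_sum_mul_monomial {d : ℕ} {f : A K} (hf : f ∈ Abar K)
    (hd : f ∈ ⨆ (k : ℕ) (_ : k ≤ d), H K k) :
    ∃ q : List (Fin 2) → A K, (∀ w, q w ∈ H K 1) ∧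
      f = ∑ w ∈ wordsLE d, q w * monomial K w := by
  classical
  let p : A K → Prop := fun f => ∃ (c : K) (q : List (Fin 2) → A K), (∀ w, q w ∈ H K 1) ∧
    f = c • 1 + ∑ w ∈ wordsLE d, q w * monomial K w
  have hzero : p 0 := ⟨0, fun _ => 0, fun _ => zero_mem _, by simp⟩
  have hadd : ∀ x y, p x → p y → p (x + y) := by
    rintro _ _ ⟨c, q, hq, rfl⟩ ⟨c', q', hq', rfl⟩
    refine ⟨c + c', fun w => q w + q' w, fun w => add_mem (hq w) (hq' w), ?_⟩
    simp only [add_mul, add_smul, Finset.sum_add_distrib]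
    abel
  have hp : p f := by
    refine Submodule.iSup_induction _ (motive := p) hd (fun k x hx => ?_) hzero hadd
    by_cases hk : k ≤ d
    swap
    · rw [iSup_neg hk, Submodule.mem_bot] at hx
      rwa [hx]
    rw [iSup_pos hk] at hx
    induction hx using H_induction with
    | mon w hw =>
      cases w with
      | nil => exact ⟨1, fun _ => 0, fun _ => zero_mem _, by simp [monomial_nil]⟩
      | cons i v =>
        refine ⟨0, fun w => if w = v then monomial K [i] else 0, fun w => ?_, ?_⟩
        · beta_reduce
          split_ifs
          · exact monomial_mem_H [i]
          · exact zero_mem _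
        · have hv : v ∈ wordsLE d := mem_wordsLE.2 (by simp at hw; omega)
          simp only [ite_mul, zero_mul, zero_smul, zero_add]
          rw [Finset.sum_ite_eq' _ v, if_pos hv, ← monomial_append, List.singleton_append]
    | zero => exact hzero
    | add x y _ _ hx hy => exact hadd x y hx hy
    | smul a x _ hx =>
      obtain ⟨c, q, hq, rfl⟩ := hx
      refine ⟨a * c, fun w => a • q w, fun w => Submodule.smul_mem _ a (hq w), ?_⟩
      simp only [smul_add, mul_smul, Finset.smul_sum, smul_mul_assoc]
  obtain ⟨c, q, hq, h⟩ := hp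
  have hsum : ∑ w ∈ wordsLE d, q w * monomial K w ∈ Abar K := by
    refine sum_mem fun w _ => ?_
    exact mem_Abar_of_mem_H (by omega) (mul_mem_H (hq w) (monomial_mem_H w))
  have hc : c = 0 := by
    have h₁ : FreeAlgebra.algebraMapInv f = (0 : K) := hf
    have h₂ : FreeAlgebra.algebraMapInv (∑ w ∈ wordsLE d, q w * monomial K w) = (0 : K) := hsum
    rwa [h, map_add, h₂, map_smul, map_one, add_zero, smul_eq_mul, mul_one] at h₁
  rw [hc, zero_smul, zero_add] at h
  exact ⟨q, hq, h⟩

/-- One step of the reading process. `P` emits the first letter of a nonempty pending word; `Q` acts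
when nothing is pending and opens a new factor `f`, lowering the exponent by one. -/
theorem exists_transition {d : ℕ} {f : A K} (hf : f ∈ Abar K)
    (hd : f ∈ ⨆ (k : ℕ) (_ : k ≤ d), H K k) :
    ∃ P Q : List (Fin 2) → List (Fin 2) → A K, (∀ v w, P v w ∈ H K 1) ∧ (∀ v w, Q v w ∈ H K 1) ∧
      ∀ v ∈ wordsLE d, ∀ n, monomial K v * f ^ (n + 1) =
        ∑ w ∈ wordsLE d, P v w * (monomial K w * f ^ (n + 1)) +
          ∑ w ∈ wordsLE d, Q v w * (monomial K w * f ^ n) := by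
  classical
  obtain ⟨q, hq, hfq⟩ := exists_eq_sum_mul_monomial hf hd
  refine ⟨fun v w => if v = [] then 0 else if w = v.tail then monomial K (v.take 1) else 0,
    fun v w => if v = [] then q w else 0, fun v w => ?_, fun v w => ?_, fun v hv n => ?_⟩
  · cases v with
    | nil => simp
    | cons i v =>
      simp only [reduceCtorEq, if_false]
      split_ifs
      · exact monomial_mem_H [i]
      · exact zero_mem _
  · beta_reduce
    split_ifs
    · exact hq w
    · exact zero_mem _
  · cases v with
    | nil =>
      simp only [if_true, zero_mul, Finset.sum_const_zero, zero_add, ← mul_assoc]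
      rw [← Finset.sum_mul, ← hfq, monomial_nil, one_mul, pow_succ']
    | cons i v =>
      have hv' : v ∈ wordsLE d := mem_wordsLE.2 (by
        have := mem_wordsLE.1 hv
        simp at this
        omega)
      simp only [reduceCtorEq, if_false, zero_mul, Finset.sum_const_zero, add_zero]
      rw [Finset.sum_eq_single v, if_pos (List.tail_cons (a := i)).symm, ← mul_assoc, ← monomial_append]
      · rfl
      · intro w _ hw
        rw [if_neg (by simpa using hw), zero_mul]
      · exact fun h => absurd hv' h

theorem exists_expansion {d : ℕ} {f : A K} (hf : f ∈ Abar K)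
    (hd : f ∈ ⨆ (k : ℕ) (_ : k ≤ d), H K k) (p : ℕ) :
    ∃ G : List (Fin 2) → List (Fin 2) → ℕ → A K, (∀ v w t, G v w t ∈ H K p) ∧
      ∀ v ∈ wordsLE d, ∀ n, p ≤ n → monomial K v * f ^ n =
        ∑ t ∈ Finset.range (p + 1), ∑ w ∈ wordsLE d, G v w t * (monomial K w * f ^ (n - t)) := by
  classical
  obtain ⟨P, Q, hP, hQ, hPQ⟩ := exists_transition hf hd
  induction p with
  | zero =>
    refine ⟨fun v w _ => if w = v then 1 else 0, fun v w t => ?_, fun v hv n _ => ?_⟩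
    · beta_reduce
      split_ifs
      · exact one_mem_H
      · exact zero_mem _
    · simp only [ite_mul, zero_mul, one_mul]
      rw [Finset.sum_range_one, Finset.sum_ite_eq' _ v, if_pos hv, Nat.sub_zero]
  | succ p ih =>
    obtain ⟨G, hG, hGf⟩ := ih
    -- The index `t` counts opened factors: `P` keeps it, `Q` raises it. The first guard excludes `t
    -- = p + 1`, where the inductive coefficients `G` are not controlled.
    refine ⟨fun v w t => (if t < p + 1 then ∑ u ∈ wordsLE d, G v u t * P u w else 0) +
      (if t = 0 then 0 else ∑ u ∈ wordsLE d, G v u (t - 1) * Q u w), fun v w t => ?_,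
      fun v hv n hn => ?_⟩
    · refine add_mem ?_ ?_ <;> split_ifs <;> first
        | exact zero_mem _
        | exact Submodule.sum_mem _ fun u _ => mul_mem_H (hG v u _) (hP u w)
        | exact Submodule.sum_mem _ fun u _ => mul_mem_H (hG v u _) (hQ u w)
    · have h₁ : ∀ t ∈ Finset.range (p + 1), ∀ u ∈ wordsLE d,
          G v u t * (monomial K u * f ^ (n - t)) =
            ∑ w ∈ wordsLE d, G v u t * P u w * (monomial K w * f ^ (n - t)) +
            ∑ w ∈ wordsLE d, G v u t * Q u w * (monomial K w * f ^ (n - (t + 1))) := by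
        intro t ht u hu
        have ht' := Finset.mem_range.1 ht
        have h := hPQ u hu (n - (t + 1))
        rw [show n - (t + 1) + 1 = n - t by omega] at h
        rw [h, mul_add, Finset.mul_sum, Finset.mul_sum]
        simp only [mul_assoc]
      rw [hGf v hv n (by omega)]
      simp only [add_mul, Finset.sum_add_distrib]
      rw [Finset.sum_congr rfl fun t ht => Finset.sum_congr rfl (h₁ t ht)]
      simp only [Finset.sum_add_distrib]
      congr 1
      · rw [Finset.sum_range_succ _ (p + 1)]
        simp only [lt_self_iff_false, if_false, zero_mul, Finset.sum_const_zero, add_zero]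
        refine Finset.sum_congr rfl fun t ht => ?_
        rw [Finset.sum_comm]
        simp only [if_pos (Finset.mem_range.1 ht), Finset.sum_mul]
      · rw [Finset.sum_range_succ' _ (p + 1)]
        simp only [if_true, zero_mul, Finset.sum_const_zero, add_zero, Nat.succ_ne_zero, if_false,
          Nat.add_sub_cancel]
        refine Finset.sum_congr rfl fun t _ => ?_
        rw [Finset.sum_comm]
        simp only [Finset.sum_mul]

/-- Emit `p` letters of `f^N` to bring the left factor to a length divisible by `W`. At most `p ≤ W`
factors are opened, so at least `W` remain and `hF` applies. -/
theorem mul_pow_mem_iSup {d : ℕ} {f : A K} (hf : f ∈ Abar K)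
    (hd : f ∈ ⨆ (k : ℕ) (_ : k ≤ d), H K k) {W N : ℕ} (hW : 0 < W) (hN : 2 * W ≤ N)
    {F : Submodule K (A K)} (hF : ∀ n, W ≤ n → ∀ w ∈ wordsLE d, monomial K w * f ^ n ∈ F * ⊤)
    (a : A K) : a * f ^ N ∈ ⨆ k : ℕ, H K (k * W) * F * ⊤ := by
  induction a using A_induction with
  | mon u =>
    have h₁ := Nat.div_add_mod u.length W
    have h₂ := Nat.mod_lt u.length hW
    obtain ⟨p, hp⟩ : ∃ p, u.length + p = (u.length / W + 1) * W :=
      ⟨W - u.length % W, by rw [add_mul, mul_comm]; omega⟩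
    have hpW : p ≤ W := by rw [add_mul, mul_comm] at hp; omega
    obtain ⟨G, hG, hGf⟩ := exists_expansion hf hd p
    have h := hGf [] (mem_wordsLE.2 (by simp)) N (by omega)
    rw [monomial_nil, one_mul] at h
    rw [h, Finset.mul_sum]
    refine Submodule.sum_mem _ fun t ht => ?_
    rw [Finset.mul_sum]
    refine Submodule.sum_mem _ fun w hw => Submodule.mem_iSup_of_mem (u.length / W + 1) ?_
    have ht' := Finset.mem_range.1 ht
    rw [← mul_assoc, ← hp, mul_assoc (H K _)]
    exact Submodule.mul_mem_mul (mul_mem_H (monomial_mem_H u) (hG _ _ _)) (hF _ (by omega) w hw)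
  | zero => rw [zero_mul]; exact zero_mem _
  | add x y hx hy => rw [add_mul]; exact add_mem hx hy
  | smul c x hx => rw [smul_mul_assoc]; exact Submodule.smul_mem _ c hx

theorem span_pow_le_iSup {f : A K} {W N : ℕ} {F : Submodule K (A K)}
    (h : ∀ a, a * f ^ N ∈ ⨆ k : ℕ, H K (k * W) * F * ⊤) :
    ∀ g ∈ TwoSidedIdeal.span {f ^ N}, g ∈ ⨆ k : ℕ, H K (k * W) * F * ⊤ := by
  intro g hg
  have hright : ∀ x ∈ ⨆ k : ℕ, H K (k * W) * F * ⊤, ∀ b : A K,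
      x * b ∈ ⨆ k : ℕ, H K (k * W) * F * ⊤ := by
    intro x hx b
    have hxb := Submodule.mul_mem_mul hx (Submodule.mem_top : b ∈ (⊤ : Submodule K (A K)))
    rw [Submodule.iSup_mul] at hxb
    have hle : ⨆ k : ℕ, H K (k * W) * F * ⊤ * ⊤ ≤ ⨆ k : ℕ, H K (k * W) * F * ⊤ :=
      iSup_mono fun k => by
        rw [mul_assoc _ ⊤]
        exact mul_le_mul' le_rfl le_top
    exact hle hxb
  -- The target is closed under right but not visibly under left multiplication, so the induction
  -- carries all left multiples.
  have h' : ∀ a, a * g ∈ ⨆ k : ℕ, H K (k * W) * F * ⊤ := by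
    induction hg using TwoSidedIdeal.span_induction with
    | mem x hx => obtain rfl := hx; exact h
    | zero => intro a; rw [mul_zero]; exact zero_mem _
    | add x y _ _ hx hy => intro a; rw [mul_add]; exact add_mem (hx a) (hy a)
    | neg x _ hx => intro a; rw [mul_neg]; exact neg_mem (hx a)
    | left_absorb b x _ hx => intro a; rw [← mul_assoc]; exact hx _
    | right_absorb b x _ hx => intro a; rw [← mul_assoc]; exact hright _ (hx a) b
  rw [← one_mul g]
  exact h' 1

theorem exists_capturing {d : ℕ} {f : A K} (hf : f ∈ Abar K)
    (hd : f ∈ ⨆ (k : ℕ) (_ : k ≤ d), H K k) {W : ℕ} (hW : 0 < W) :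
    ∃ F : Submodule K (A K), F ≤ H K W ∧
      Module.finrank K F ≤ (wordsLE d).card ^ 2 * (W + 1) ∧
      ∀ N, 2 * W ≤ N → ∀ g ∈ TwoSidedIdeal.span {f ^ N},
        g ∈ ⨆ k : ℕ, H K (k * W) * F * ⊤ := by
  classical
  obtain ⟨G, hG, hGf⟩ := exists_expansion hf hd W
  -- One generator for each start state, end state and number of opened factors.
  let T : Finset (A K) := (wordsLE d ×ˢ wordsLE d ×ˢ Finset.range (W + 1)).image
    fun x => G x.1 x.2.1 x.2.2
  refine ⟨Submodule.span K T, ?_, ?_, fun N hN =>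
    span_pow_le_iSup (mul_pow_mem_iSup hf hd hW hN fun n hn v hv => ?_)⟩
  · rw [Submodule.span_le]
    intro x hx
    obtain ⟨y, _, rfl⟩ := Finset.mem_image.1 hx
    exact hG _ _ _
  · refine (finrank_span_finset_le_card T).trans (Finset.card_image_le.trans ?_)
    rw [Finset.card_product, Finset.card_product, Finset.card_range]
    exact le_of_eq (by ring)
  · rw [hGf v hv n hn]
    refine Submodule.sum_mem _ fun t ht => Submodule.sum_mem _ fun w hw =>
      Submodule.mul_mem_mul (Submodule.subset_span ?_) Submodule.mem_top
    exact Finset.mem_image.2 ⟨(v, w, t), by simp only [Finset.mem_product]; exact ⟨hv, hw, ht⟩, rfl⟩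

theorem log_lt_two_pow (i : ℕ) : Nat.log 2 i < 2 ^ i :=
  (Nat.log_le_self 2 i).trans_lt Nat.lt_two_pow_self

theorem card_mul_lt {d i : ℕ} (hd : 6 ^ (6 * d) < Nat.log 2 i) :
    (wordsLE d).card ^ 2 * (2 ^ ex i + 1) < 2 ^ 2 ^ i - 2 := by
  have hlog := log_lt_two_pow i
  have h₁ : 2 ^ 2 ^ i = 2 ^ ex i * 2 ^ Nat.log 2 i := by
    rw [← pow_add, ex, Nat.sub_add_cancel hlog.le]
  have h₂ : 2 ≤ 2 ^ ex i := by
    calc 2 = 2 ^ 1 := rfl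
      _ ≤ 2 ^ ex i := Nat.pow_le_pow_right (by norm_num) (by unfold ex; omega)
  rw [h₁]
  -- For `d = 0` only `Nat.log 2 i ≥ 2` is available, but then there is a single word.
  rcases Nat.eq_zero_or_pos d with rfl | hd₀
  · have h₃ : 2 ^ 2 ≤ 2 ^ Nat.log 2 i := Nat.pow_le_pow_right (by norm_num) (Nat.succ_le_of_lt (by simpa using hd))
    have h₄ : 2 ^ ex i * 2 ^ 2 ≤ 2 ^ ex i * 2 ^ Nat.log 2 i := Nat.mul_le_mul_left _ h₃
    simp only [wordsLE, Finset.card_singleton]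
    omega
  · have h₃ : 2 * d + 4 ≤ Nat.log 2 i := by
      have : 6 * d < 6 ^ (6 * d) := Nat.lt_pow_self (by norm_num)
      omega
    have h₄ : (wordsLE d).card ^ 2 ≤ 2 ^ (2 * d + 2) := by
      rw [show 2 * d + 2 = (d + 1) * 2 by ring, pow_mul]
      exact Nat.pow_le_pow_left (card_wordsLE_lt d).le 2
    have h₅ : 2 ^ (2 * d + 4) ≤ 2 ^ Nat.log 2 i := Nat.pow_le_pow_right (by norm_num) h₃
    have h₆ : 2 ^ (2 * d + 4) = 4 * 2 ^ (2 * d + 2) := by rw [pow_add, pow_add]; ring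
    have h₇ : 0 < 2 ^ (2 * d + 2) := by positivity
    have h₈ := Nat.mul_le_mul_left (2 ^ ex i) h₅
    have h₉ := Nat.mul_le_mul_right (2 ^ ex i + 1) h₄
    rw [h₆] at h₈
    have h₁₀ : 2 * 2 ^ (2 * d + 2) ≤ 2 ^ ex i * 2 ^ (2 * d + 2) := Nat.mul_le_mul_right _ h₂
    have h₁₁ : 4 ≤ 2 ^ (2 * d + 2) := by
      calc 4 = 2 ^ 2 := rfl
        _ ≤ _ := Nat.pow_le_pow_right (by norm_num) (by omega)
    have h₁₂ : 2 ^ (2 * d + 2) * (2 ^ ex i + 1) =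
      2 ^ ex i * 2 ^ (2 * d + 2) + 2 ^ (2 * d + 2) := by ring
    have h₁₃ : 2 ^ ex i * (4 * 2 ^ (2 * d + 2)) = 4 * (2 ^ ex i * 2 ^ (2 * d + 2)) := by ring
    omega

theorem exists_isCapturing {Z : Set ℕ} {f : ℕ → A K} (h : IsSparseEnumeration Z f) :
    ∃ F, IsCapturing Z f F := by
  have h' : ∀ i, ∃ F : Submodule K (A K), i ∈ Z → F ≤ H K (2 ^ ex i) ∧
      Module.finrank K F < 2 ^ 2 ^ i - 2 ∧
      ∀ g ∈ TwoSidedIdeal.span {f i ^ (10 * (4 * 2 ^ ex i))},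
        g ∈ ⨆ k : ℕ, H K (k * 2 ^ ex i) * F * ⊤ := by
    intro i
    by_cases hi : i ∈ Z
    · have hf : f i ∈ Abar K := by
        rw [← SetLike.mem_coe, ← h.enumerates]
        exact ⟨i, hi, rfl⟩
      obtain ⟨F, h₁, h₂, h₃⟩ := exists_capturing hf (mem_iSup_H_deg (f i))
        (by positivity : 0 < 2 ^ ex i)
      exact ⟨F, fun _ => ⟨h₁, h₂.trans_lt (card_mul_lt (h.deg_lt i hi)),
        h₃ _ (by omega)⟩⟩
    · exact ⟨⊥, fun h => absurd h hi⟩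
  choose F hF using h'
  exact ⟨F, fun i hi => (hF i hi).1, fun i hi => (hF i hi).2.1, fun i hi => (hF i hi).2.2⟩

/-! ### A sparse enumeration -/

theorem exists_isSparseEnumeration (K : Type*) [Field K] [Countable K] :
    ∃ (Z : Set ℕ) (f : ℕ → A K), IsSparseEnumeration Z f := by
  have : Countable (A K) := (wordBasis K).repr.injective.countable
  obtain ⟨g, hg⟩ := exists_surjective_nat (Abar K)
  -- `b` meets the lower bounds on the index of `g n`; `idx` adds the sparsity gap between
  -- neighbours, and monotonicity extends the gap to all pairs.
  let b : ℕ → ℕ := fun n => max 5 (2 ^ (6 ^ (6 * deg (g n : A K)) + 1))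
  let idx : ℕ → ℕ := fun n => Nat.rec (b 0) (fun n x => b (n + 1) + 2 ^ 2 ^ 2 ^ (2 * x) + 1) n
  have hb : ∀ n, b n ≤ idx n := by
    intro n
    cases n with
    | zero => exact le_rfl
    | succ n => change b (n + 1) ≤ b (n + 1) + 2 ^ 2 ^ 2 ^ (2 * idx n) + 1; exact Nat.le_add_right_of_le (Nat.le_add_right _ _)
  have hstep : ∀ n, 2 ^ 2 ^ 2 ^ (2 * idx n) < idx (n + 1) := fun n => by
    change _ < b (n + 1) + 2 ^ 2 ^ 2 ^ (2 * idx n) + 1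
    exact Nat.lt_succ_of_le (Nat.le_add_left _ _)
  have hmono : StrictMono idx := strictMono_nat_of_lt_succ fun n => by
    refine lt_trans ?_ (hstep n)
    have h₁ : 2 * idx n < 2 ^ (2 * idx n) := Nat.lt_two_pow_self
    have h₂ : 2 ^ (2 * idx n) < 2 ^ 2 ^ (2 * idx n) := Nat.lt_two_pow_self
    have h₃ : 2 ^ 2 ^ (2 * idx n) < 2 ^ 2 ^ 2 ^ (2 * idx n) := Nat.lt_two_pow_self
    omega
  refine ⟨Set.range idx, Function.extend idx (fun n => (g n : A K)) 0, ?_, ?_, ?_, ?_⟩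
  · rintro _ ⟨n, rfl⟩
    exact (le_max_left _ _).trans (hb n)
  · rw [← Set.range_comp]
    ext x
    constructor
    · rintro ⟨n, rfl⟩
      rw [Function.comp_apply, hmono.injective.extend_apply]
      exact (g n).2
    · intro hx
      obtain ⟨n, hn⟩ := hg ⟨x, hx⟩
      refine ⟨n, ?_⟩
      rw [Function.comp_apply, hmono.injective.extend_apply, hn]
  · rintro _ ⟨n, rfl⟩
    rw [hmono.injective.extend_apply]
    exact Nat.lt_of_succ_le (Nat.le_log_of_pow_le (by norm_num) ((le_max_right _ _).trans (hb n)))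
  · rintro _ ⟨m, rfl⟩ _ ⟨n, rfl⟩ h
    exact (hstep n).trans_le (hmono.monotone (hmono.lt_iff_lt.1 h))

/-! ### Word-spanned complements -/

/-- The span of the monomials given by the words in `s`. -/
def wordSpan (K : Type*) [Field K] (s : Finset (List (Fin 2))) : Submodule K (A K) :=
  Submodule.span K (monomial K '' s)

theorem monomial_mem_wordSpan {s : Finset (List (Fin 2))} {w : List (Fin 2)} (hw : w ∈ s) :
    monomial K w ∈ wordSpan K s :=
  Submodule.subset_span ⟨w, hw, rfl⟩

theorem wordSpan_mono {s t : Finset (List (Fin 2))} (h : s ⊆ t) : wordSpan K s ≤ wordSpan K t :=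
  Submodule.span_mono (Set.image_mono h)

instance finiteDimensional_wordSpan (s : Finset (List (Fin 2))) :
    FiniteDimensional K (wordSpan K s) :=
  FiniteDimensional.span_of_finite K (s.finite_toSet.image _)

theorem finrank_wordSpan (s : Finset (List (Fin 2))) : Module.finrank K (wordSpan K s) = s.card := by
  have h : LinearIndependent K fun w : s => monomial K (w : List (Fin 2)) :=
    linearIndependent_monomial.comp _ Subtype.val_injective
  have h' := finrank_span_eq_card h
  rw [Fintype.card_coe] at h'
  rw [← h', wordSpan, Set.image_eq_range]
  rfl

theorem wordSpan_union (s t : Finset (List (Fin 2))) :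
    wordSpan K (s ∪ t) = wordSpan K s ⊔ wordSpan K t := by
  rw [wordSpan, Finset.coe_union, Set.image_union, Submodule.span_union]
  rfl

theorem wordSpan_singleton (w : List (Fin 2)) :
    wordSpan K {w} = Submodule.span K {monomial K w} := by
  rw [wordSpan, Finset.coe_singleton, Set.image_singleton]

theorem disjoint_wordSpan {s t : Finset (List (Fin 2))} (h : Disjoint s t) :
    Disjoint (wordSpan K s) (wordSpan K t) :=
  linearIndependent_monomial.disjoint_span_image (Finset.disjoint_coe.2 h)

/-- All concatenations of two words from `s`. -/
def concat (s : Finset (List (Fin 2))) : Finset (List (Fin 2)) :=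
  (s ×ˢ s).image fun x => x.1 ++ x.2

theorem mem_concat {s : Finset (List (Fin 2))} {w : List (Fin 2)} :
    w ∈ concat s ↔ ∃ u ∈ s, ∃ v ∈ s, u ++ v = w := by
  simp only [concat, Finset.mem_image, Finset.mem_product, Prod.exists]
  grind

theorem card_concat {s : Finset (List (Fin 2))} {N : ℕ} (hs : ∀ w ∈ s, w.length = N) :
    (concat s).card = s.card ^ 2 := by
  rw [concat, Finset.card_image_of_injOn, Finset.card_product, sq]
  rintro ⟨u, v⟩ h ⟨u', v'⟩ h' he
  simp only [Finset.coe_product, Set.mem_prod, Finset.mem_coe] at h h'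
  obtain ⟨rfl, rfl⟩ := List.append_inj he (by rw [hs u h.1, hs u' h'.1])
  rfl

theorem wordSpan_concat (s : Finset (List (Fin 2))) :
    wordSpan K (concat s) = wordSpan K s * wordSpan K s := by
  rw [wordSpan, wordSpan, Submodule.span_mul_span]
  congr 1
  ext x
  constructor
  · rintro ⟨w, hw, rfl⟩
    obtain ⟨u, hu, v, hv, rfl⟩ := mem_concat.1 hw
    exact ⟨_, ⟨u, hu, rfl⟩, _, ⟨v, hv, rfl⟩, (monomial_append u v).symm⟩
  · rintro ⟨_, ⟨u, hu, rfl⟩, _, ⟨v, hv, rfl⟩, rfl⟩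
    exact ⟨u ++ v, mem_concat.2 ⟨u, hu, v, hv, rfl⟩, monomial_append u v⟩

/-- `H(N)` is the direct sum of the span of the words in `s` and of `U`. -/
structure IsSplitting (N : ℕ) (U : Submodule K (A K)) (s : Finset (List (Fin 2))) : Prop where
  length_eq : ∀ w ∈ s, w.length = N
  le : U ≤ H K N
  disjoint : Disjoint (wordSpan K s) U
  sup_eq : wordSpan K s ⊔ U = H K N

namespace IsSplitting

variable {N : ℕ} {U : Submodule K (A K)} {s : Finset (List (Fin 2))}

theorem wordSpan_le (h : IsSplitting N U s) : wordSpan K s ≤ H K N :=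
  le_sup_left.trans h.sup_eq.le

theorem concat (h : IsSplitting N U s) :
    IsSplitting (N + N) (H K N * U ⊔ U * H K N) (concat s) where
  length_eq w hw := by
    obtain ⟨u, hu, v, hv, rfl⟩ := mem_concat.1 hw
    rw [List.length_append, h.length_eq u hu, h.length_eq v hv]
  le := by
    rw [← H_mul]
    exact sup_le (mul_le_mul' le_rfl h.le) (mul_le_mul' h.le le_rfl)
  disjoint := by
    rw [wordSpan_concat, disjoint_iff]
    exact mul_inf_eq_bot h.le h.wordSpan_le (disjoint_iff.1 h.disjoint)
  sup_eq := by
    refine le_antisymm (sup_le ?_ (sup_le ?_ ?_)) ?_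
    · rw [wordSpan_concat, ← H_mul]
      exact mul_le_mul' h.wordSpan_le h.wordSpan_le
    · rw [← H_mul]
      exact mul_le_mul' le_rfl h.le
    · rw [← H_mul]
      exact mul_le_mul' h.le le_rfl
    · rw [wordSpan_concat, ← H_mul]
      nth_rw 1 [← h.sup_eq]
      rw [Submodule.sup_mul]
      refine sup_le ?_ (le_sup_of_le_right le_sup_right)
      nth_rw 1 [← h.sup_eq]
      rw [Submodule.mul_sup]
      exact sup_le le_sup_left
        (le_sup_of_le_right (le_sup_of_le_left (mul_le_mul' h.wordSpan_le le_rfl)))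

/-- Discarded words move into `U`. -/
theorem subset (h : IsSplitting N U s) {t : Finset (List (Fin 2))} (ht : t ⊆ s) :
    IsSplitting N (U ⊔ wordSpan K (s \ t)) t where
  length_eq w hw := h.length_eq w (ht hw)
  le := sup_le h.le ((wordSpan_mono Finset.sdiff_subset).trans h.wordSpan_le)
  disjoint := by
    rw [sup_comm]
    refine Disjoint.disjoint_sup_right_of_disjoint_sup_left
      (disjoint_wordSpan Finset.disjoint_sdiff) ?_
    rw [← wordSpan_union, Finset.union_sdiff_of_subset ht]
    exact h.disjoint
  sup_eq := by
    rw [sup_comm U, ← sup_assoc, ← wordSpan_union, Finset.union_sdiff_of_subset ht, h.sup_eq]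

theorem card_add_finrank (h : IsSplitting N U s) :
    s.card + Module.finrank K U = Module.finrank K (H K N) := by
  have : FiniteDimensional K U := Submodule.finiteDimensional_of_le h.le
  have e := Submodule.finrank_sup_add_finrank_inf_eq (wordSpan K s) U
  rw [disjoint_iff.1 h.disjoint, finrank_bot, add_zero, h.sup_eq, finrank_wordSpan] at e
  exact e.symm

/-- A maximal set of words independent modulo `U ⊔ Q` spans a complement of it by exchange;
comparing dimensions shows that at most `finrank Q` words are lost. -/
theorem exists_subset (h : IsSplitting N U s) {Q : Submodule K (A K)} (hQ : Q ≤ H K N) :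
    ∃ t ⊆ s, IsSplitting N (U ⊔ Q) t ∧ s.card ≤ t.card + Module.finrank K Q := by
  classical
  obtain ⟨t, ht, hmax⟩ := (s.powerset.filter fun t =>
    Disjoint (U ⊔ Q) (wordSpan K t)).exists_max_image Finset.card
      ⟨∅, Finset.mem_filter.2 ⟨Finset.empty_mem_powerset s, by simp [wordSpan]⟩⟩
  rw [Finset.mem_filter, Finset.mem_powerset] at ht
  obtain ⟨hts, hdisj⟩ := ht
  have hmem : ∀ w ∈ s, monomial K w ∈ U ⊔ Q ⊔ wordSpan K t := by
    intro w hw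
    by_cases hwt : w ∈ t
    · exact le_sup_right (a := U ⊔ Q) (monomial_mem_wordSpan hwt)
    by_contra hnot
    have h₁ : Disjoint (U ⊔ Q ⊔ wordSpan K t) (wordSpan K {w}) := by
      rw [wordSpan_singleton]
      exact (Submodule.disjoint_span_singleton'
        (linearIndependent_monomial.ne_zero w)).2 hnot
    have h₂ := Disjoint.disjoint_sup_right_of_disjoint_sup_left hdisj h₁
    rw [← wordSpan_union] at h₂
    have h₃ := hmax (t ∪ {w}) (by
      rw [Finset.mem_filter, Finset.mem_powerset]
      exact ⟨Finset.union_subset hts (Finset.singleton_subset_iff.2 hw), h₂⟩)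
    rw [Finset.card_union_of_disjoint (Finset.disjoint_singleton_right.2 hwt),
      Finset.card_singleton] at h₃
    omega
  have ht : IsSplitting N (U ⊔ Q) t :=
    { length_eq := fun w hw => h.length_eq w (hts hw)
      le := sup_le h.le hQ
      disjoint := hdisj.symm
      sup_eq := by
        refine le_antisymm
          (sup_le ((wordSpan_mono hts).trans h.wordSpan_le) (sup_le h.le hQ)) ?_
        rw [← h.sup_eq, sup_comm (wordSpan K t)]
        refine sup_le (Submodule.span_le.2 ?_) (le_sup_of_le_left le_sup_left)
        rintro _ ⟨w, hw, rfl⟩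
        exact hmem w hw }
  refine ⟨t, hts, ht, ?_⟩
  have : FiniteDimensional K U := Submodule.finiteDimensional_of_le h.le
  have : FiniteDimensional K Q := Submodule.finiteDimensional_of_le hQ
  have h₁ := h.card_add_finrank
  have h₂ := ht.card_add_finrank
  have h₃ := Submodule.finrank_add_le_finrank_add_finrank U Q
  omega

end IsSplitting

/-! ### The blocks of `S` -/

/-- The first element of the block of `S` that belongs to `i`. -/
def blockStart (i : ℕ) : ℕ := 2 ^ i - i - Nat.log 2 i

theorem three_mul_lt_two_pow {i : ℕ} (hi : 5 ≤ i) : 3 * i < 2 ^ i := by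
  induction i, hi using Nat.le_induction with
  | base => norm_num
  | succ i hi ih => rw [pow_succ]; omega

theorem lt_blockStart {i : ℕ} (hi : 5 ≤ i) : i < blockStart i := by
  have h₁ := three_mul_lt_two_pow hi
  have h₂ := Nat.log_le_self 2 i
  unfold blockStart
  omega

theorem blockStart_add {i : ℕ} (hi : 5 ≤ i) : blockStart i + i = ex i := by
  have h₁ := three_mul_lt_two_pow hi
  have h₂ := Nat.log_le_self 2 i
  unfold blockStart ex
  omega

section Blocks

variable {Z : Set ℕ}

theorem mem_S_iff (hZ : ∀ i ∈ Z, 5 ≤ i) {n : ℕ} :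
    n ∈ S Z ↔ ∃ i ∈ Z, blockStart i ≤ n ∧ n < ex i := by
  simp only [S, Set.mem_iUnion, Set.mem_Icc, exists_prop]
  refine exists_congr fun i => and_congr_right fun hi => ?_
  have h := blockStart_add (hZ i hi)
  have h' := hZ i hi
  change blockStart i ≤ n ∧ n ≤ ex i - 1 ↔ _
  omega

/-- Blocks stay disjoint even with the endpoint `ex i` added, since `j < i` gives `ex j ≤ 2^j < i <
blockStart i`. So the degree where `F_i` is absorbed lies in no other block. -/
theorem block_unique (hZ : ∀ i ∈ Z, 5 ≤ i)
    (hsparse : ∀ i ∈ Z, ∀ j ∈ Z, j < i → 2 ^ 2 ^ 2 ^ (2 * j) < i) {n i j : ℕ}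
    (hi : i ∈ Z) (hj : j ∈ Z) (hi₁ : blockStart i ≤ n) (hi₂ : n ≤ ex i)
    (hj₁ : blockStart j ≤ n) (hj₂ : n ≤ ex j) : i = j := by
  have key : ∀ i ∈ Z, ∀ j ∈ Z, j < i → ex j < blockStart i := by
    intro i hi j hj hij
    have h₁ : 2 * j < 2 ^ (2 * j) := Nat.lt_two_pow_self
    have h₂ : 2 ^ (2 * j) < 2 ^ 2 ^ (2 * j) := Nat.lt_two_pow_self
    have h₃ : 2 ^ j ≤ 2 ^ 2 ^ 2 ^ (2 * j) := Nat.pow_le_pow_right (by norm_num) (by omega)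
    have h₄ := hsparse i hi j hj hij
    have h₅ := lt_blockStart (hZ i hi)
    have h₆ : ex j ≤ 2 ^ j := Nat.sub_le _ _
    omega
  rcases lt_trichotomy i j with h | h | h
  · have := key j hj i hi h
    omega
  · exact h
  · have := key i hi j hj h
    omega

end Blocks

/-! ### Recursive construction of `U` and `V` -/

/-- The properties of a pair of `U(2^n)` and of the set of words that span `V(2^n)`. -/
structure IsStage (Z : Set ℕ) (F : ℕ → Submodule K (A K)) (n : ℕ)
    (p : Submodule K (A K) × Finset (List (Fin 2))) : Prop where
  splitting : IsSplitting (2 ^ n) p.1 p.2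
  card_of_notMem : n ∉ S Z → p.2.card = 2
  card_of_mem : ∀ i ∈ Z, ∀ j, j ≤ i - 1 → n = blockStart i + j → p.2.card = 2 ^ 2 ^ j
  F_le : ∀ i ∈ Z, n = ex i → F i ≤ p.1

/-- The relation between two consecutive stages. -/
structure IsStageStep (Z : Set ℕ) (n : ℕ)
    (p q : Submodule K (A K) × Finset (List (Fin 2))) : Prop where
  ideal_like : H K (2 ^ n) * p.1 ⊔ p.1 * H K (2 ^ n) ≤ q.1
  subset : q.2 ⊆ concat p.2
  monomials : n ∉ S Z → ∃ w₁ ∈ p.2, ∃ w₂ ∈ p.2, p.2 = {w₁, w₂} ∧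
    ∀ h ∈ H K (2 ^ n), monomial K w₂ * h ∈ q.1

section Stages

variable {Z : Set ℕ} {F : ℕ → Submodule K (A K)}

theorem isStage_zero (hZ : ∀ i ∈ Z, 5 ≤ i) :
    IsStage Z F 0 ((⊥ : Submodule K (A K)), {[0], [1]}) where
  splitting :=
    { length_eq := by simp
      le := bot_le
      disjoint := disjoint_bot_right
      sup_eq := by
        rw [sup_bot_eq, wordSpan, H, M_eq_image]
        congr 2
        ext w
        simp only [Finset.coe_insert, Finset.coe_singleton, Set.mem_insert_iff,
          Set.mem_singleton_iff, pow_zero, Set.mem_ofPred_eq, List.length_eq_one_iff]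
        constructor
        · rintro (rfl | rfl) <;> exact ⟨_, rfl⟩
        · rintro ⟨i, rfl⟩
          fin_cases i <;> simp }
  card_of_notMem _ := rfl
  card_of_mem i hi j _ h := by
    have := lt_blockStart (hZ i hi)
    omega
  F_le i hi h := by
    have := blockStart_add (hZ i hi)
    have := hZ i hi
    omega

/-- End of a block: squaring gives `2^(2^i)` words, and adding `F i` to `U` costs fewer than
`2^(2^i) - 2` of them, so two can be kept. -/
theorem exists_stage_of_eq_ex (hZ : ∀ i ∈ Z, 5 ≤ i)
    (hsparse : ∀ i ∈ Z, ∀ j ∈ Z, j < i → 2 ^ 2 ^ 2 ^ (2 * j) < i)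
    (hF : ∀ i ∈ Z, F i ≤ H K (2 ^ ex i))
    (hdim : ∀ i ∈ Z, Module.finrank K (F i) < 2 ^ 2 ^ i - 2) {n i : ℕ} (hi : i ∈ Z)
    (hn : n + 1 = ex i) {p : Submodule K (A K) × Finset (List (Fin 2))} (hp : IsStage Z F n p) :
    ∃ q, IsStage Z F (n + 1) q ∧ IsStageStep Z n p q := by
  have h₀ := hZ i hi
  have h₁ := blockStart_add h₀
  have hcard := hp.card_of_mem i hi (i - 1) le_rfl (by omega)
  have hsq := hp.splitting.concat
  rw [← two_mul, ← pow_succ'] at hsq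
  obtain ⟨t, ht, hsplit, hle⟩ := hsq.exists_subset (hn ▸ hF i hi)
  rw [card_concat hp.splitting.length_eq, hcard, ← pow_mul, ← pow_succ,
    Nat.sub_add_cancel (by omega)] at hle
  have hd := hdim i hi
  obtain ⟨t', ht', hcard'⟩ := Finset.exists_subset_card_eq (show 2 ≤ t.card by omega)
  refine ⟨(_, t'), ⟨hsplit.subset ht', fun _ => hcard', fun i' hi' j hj h => ?_,
    fun i' hi' h => ?_⟩, ⟨le_sup_left.trans le_sup_left, ht'.trans ht, fun hS => ?_⟩⟩
  · have h₂ := blockStart_add (hZ i' hi')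
    have h₃ := hZ i' hi'
    have h₄ := block_unique hZ hsparse hi hi' (n := n + 1) (by omega) (by omega) (by omega)
      (by omega)
    subst h₄
    omega
  · have h₂ := blockStart_add (hZ i' hi')
    have h₄ := block_unique hZ hsparse hi hi' (n := n + 1) (by omega) (by omega) (by omega)
      (by omega)
    subst h₄
    exact le_sup_right.trans le_sup_left
  · exact absurd ((mem_S_iff hZ).2 ⟨i, hi, by omega, by omega⟩) hS

theorem exists_stage_of_mem (hZ : ∀ i ∈ Z, 5 ≤ i)
    (hsparse : ∀ i ∈ Z, ∀ j ∈ Z, j < i → 2 ^ 2 ^ 2 ^ (2 * j) < i) {n : ℕ} (hn : n ∈ S Z)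
    (hne : ∀ i ∈ Z, n + 1 ≠ ex i) {p : Submodule K (A K) × Finset (List (Fin 2))}
    (hp : IsStage Z F n p) : ∃ q, IsStage Z F (n + 1) q ∧ IsStageStep Z n p q := by
  obtain ⟨i, hi, h₁, h₂⟩ := (mem_S_iff hZ).1 hn
  have h₃ := hne i hi
  have h₄ := blockStart_add (hZ i hi)
  have hsq := hp.splitting.concat
  rw [← two_mul, ← pow_succ'] at hsq
  refine ⟨(_, concat p.2), ⟨hsq, fun hS => ?_, fun i' hi' j hj h => ?_,
    fun i' hi' h => absurd h (hne i' hi')⟩, ⟨le_rfl, subset_rfl, fun hS => absurd hn hS⟩⟩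
  · exact absurd ((mem_S_iff hZ).2 ⟨i, hi, by omega, by omega⟩) hS
  · have h₅ := blockStart_add (hZ i' hi')
    have h₆ := block_unique hZ hsparse hi hi' (n := n + 1) (by omega) (by omega) (by omega)
      (by omega)
    subst h₆
    obtain ⟨j, rfl⟩ : ∃ j', j = j' + 1 := ⟨j - 1, by omega⟩
    rw [card_concat hp.splitting.length_eq,
      hp.card_of_mem i hi j (by omega) (by omega), ← pow_mul, ← pow_succ]

theorem exists_stage_of_notMem (hZ : ∀ i ∈ Z, 5 ≤ i) {n : ℕ} (hn : n ∉ S Z)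
    {p : Submodule K (A K) × Finset (List (Fin 2))}
    (hp : IsStage Z F n p) : ∃ q, IsStage Z F (n + 1) q ∧ IsStageStep Z n p q := by
  obtain ⟨w₁, w₂, hne, hs⟩ := Finset.card_eq_two.1 (hp.card_of_notMem hn)
  have hw₁ : w₁ ∈ p.2 := by simp [hs]
  have hw₂ : w₂ ∈ p.2 := by simp [hs]
  have hlen := hp.splitting.length_eq
  have hsq := hp.splitting.concat
  rw [← two_mul, ← pow_succ'] at hsq
  have hsub : p.2.image (w₁ ++ ·) ⊆ concat p.2 := by
    intro w hw
    obtain ⟨v, hv, rfl⟩ := Finset.mem_image.1 hw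
    exact mem_concat.2 ⟨w₁, hw₁, v, hv, rfl⟩
  have hcard : (p.2.image (w₁ ++ ·)).card = 2 := by
    rw [Finset.card_image_of_injective _ (List.append_right_injective w₁), hp.card_of_notMem hn]
  refine ⟨(_, p.2.image (w₁ ++ ·)), ⟨hsq.subset hsub, fun _ => hcard, fun i hi j hj h => ?_,
    fun i hi h => ?_⟩, ⟨le_sup_left, hsub, fun _ => ⟨w₁, hw₁, w₂, hw₂, hs, fun h hh => ?_⟩⟩⟩
  · have h₁ := blockStart_add (hZ i hi)
    have h₂ := hZ i hi
    -- Only the first index of a block can follow an index outside `S`, and there `2^(2^0) = 2`.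
    obtain rfl : j = 0 := by
      by_contra hj₀
      exact hn ((mem_S_iff hZ).2 ⟨i, hi, by omega, by omega⟩)
    exact hcard
  · have h₁ := blockStart_add (hZ i hi)
    have h₂ := hZ i hi
    exact absurd ((mem_S_iff hZ).2 ⟨i, hi, by omega, by omega⟩) hn
  -- Split `h` along `V ⊕ U`. The `U` part gives an element of `H U`; the `V` part gives words
  -- beginning with `w₂ ≠ w₁`, which were discarded into the new `U`.
  · rw [← hp.splitting.sup_eq] at hh
    obtain ⟨v, hv, u, hu, rfl⟩ := Submodule.mem_sup.1 hh
    clear hh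
    rw [mul_add]
    refine add_mem (Submodule.mem_sup_right ?_) (Submodule.mem_sup_left (Submodule.mem_sup_left
      (Submodule.mul_mem_mul (hp.splitting.wordSpan_le (monomial_mem_wordSpan hw₂)) hu)))
    induction hv using Submodule.span_induction with
    | mem x hx =>
      obtain ⟨v, hv, rfl⟩ := hx
      rw [← monomial_append]
      refine monomial_mem_wordSpan (Finset.mem_sdiff.2
        ⟨mem_concat.2 ⟨w₂, hw₂, v, hv, rfl⟩, fun hmem => ?_⟩)
      obtain ⟨v', _, he⟩ := Finset.mem_image.1 hmem
      exact hne (List.append_inj_left he (by rw [hlen w₁ hw₁, hlen w₂ hw₂]))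
    | zero => rw [mul_zero]; exact zero_mem _
    | add x y _ _ hx hy =>
      rw [mul_add]
      exact add_mem hx hy
    | smul c x _ hx =>
      rw [mul_smul_comm]
      exact Submodule.smul_mem _ c hx

theorem exists_stage_succ (hZ : ∀ i ∈ Z, 5 ≤ i)
    (hsparse : ∀ i ∈ Z, ∀ j ∈ Z, j < i → 2 ^ 2 ^ 2 ^ (2 * j) < i)
    (hF : ∀ i ∈ Z, F i ≤ H K (2 ^ ex i))
    (hdim : ∀ i ∈ Z, Module.finrank K (F i) < 2 ^ 2 ^ i - 2) {n : ℕ}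
    {p : Submodule K (A K) × Finset (List (Fin 2))} (hp : IsStage Z F n p) :
    ∃ q, IsStage Z F (n + 1) q ∧ IsStageStep Z n p q := by
  by_cases h : ∃ i ∈ Z, n + 1 = ex i
  · obtain ⟨i, hi, hn⟩ := h
    exact exists_stage_of_eq_ex hZ hsparse hF hdim hi hn hp
  by_cases hn : n ∈ S Z
  · exact exists_stage_of_mem hZ hsparse hn (fun i hi hi' => h ⟨i, hi, hi'⟩) hp
  · exact exists_stage_of_notMem hZ hn hp

theorem exists_isUVSystem {f : ℕ → A K} (hf : IsSparseEnumeration Z f)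
    (hF : IsCapturing Z f F) : ∃ U V, IsUVSystem Z F U V := by
  have hstep : ∀ (n : ℕ) (p : {p // IsStage Z F n p}),
      ∃ q : {q // IsStage Z F (n + 1) q}, IsStageStep Z n p.1 q.1 := fun n p => by
    obtain ⟨q, hq, hpq⟩ :=
      exists_stage_succ hf.five_le hf.sparse hF.le_H hF.finrank_lt p.2
    exact ⟨⟨q, hq⟩, hpq⟩
  choose next hnext using hstep
  let p : ∀ n, {p // IsStage Z F n p} := fun n =>
    Nat.rec ⟨_, isStage_zero hf.five_le⟩ (fun n p => next n p) n
  have hp : ∀ n, IsStageStep Z n (p n).1 (p (n + 1)).1 := fun n => hnext n (p n)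
  refine ⟨fun n => (p n).1.1, fun n => wordSpan K (p n).1.2, ?_⟩
  refine
    { U_le := fun n => (p n).2.splitting.le
      V_le := fun n => (p n).2.splitting.wordSpan_le
      finrank_of_notMem := fun n _ hn => (finrank_wordSpan _).trans ((p n).2.card_of_notMem hn)
      finrank_of_mem := fun i hi j hj => (finrank_wordSpan _).trans
        ((p _).2.card_of_mem i hi j hj rfl)
      spanned := fun n _ => ⟨_, ?_, rfl⟩
      F_le := fun i hi => (p _).2.F_le i hi rfl
      disjoint := fun n _ => disjoint_iff.1 (p n).2.splitting.disjoint
      sup_eq := fun n _ => (p n).2.splitting.sup_eq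
      ideal_like := fun n _ => (hp n).ideal_like
      V_succ_le := fun n _ => (wordSpan_mono (hp n).subset).trans (wordSpan_concat _).le
      monomials := fun n _ hn => ?_ }
  · rw [M_eq_image]
    exact Set.image_mono fun w hw => (p n).2.splitting.length_eq w hw
  · obtain ⟨w₁, h₁, w₂, h₂, hs, h⟩ := (hp n).monomials hn
    have hlen := (p n).2.splitting.length_eq
    refine ⟨_, ⟨w₁, hlen w₁ h₁, rfl⟩, _, ⟨w₂, hlen w₂ h₂, rfl⟩, monomial_mem_wordSpan h₁,
      monomial_mem_wordSpan h₂, ?_, h⟩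
    rw [hs, wordSpan, Finset.coe_pair, Set.image_pair]

end Stages

/-! ### Nonvanishing of `V` and conclusion -/

theorem IsUVSystem.V_ne_bot {Z : Set ℕ} {F U V : ℕ → Submodule K (A K)}
    (hZ : ∀ i ∈ Z, 5 ≤ i) (h : IsUVSystem Z F U V) {n : ℕ} (hn : 0 < n) : V n ≠ ⊥ := by
  intro hV
  by_cases hS : n ∈ S Z
  · obtain ⟨i, hi, h₁, h₂⟩ := (mem_S_iff hZ).1 hS
    have h₃ := blockStart_add (hZ i hi)
    have h₄ := h.finrank_of_mem i hi (n - blockStart i) (by omega)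
    change Module.finrank K (V (blockStart i + (n - blockStart i))) = _ at h₄
    rw [Nat.add_sub_cancel' h₁, hV, finrank_bot] at h₄
    exact absurd h₄.symm (by positivity)
  · have h₄ := h.finrank_of_notMem n hn hS
    rw [hV, finrank_bot] at h₄
    omega

end

end NilConstruction

theorem mainTheorem2 (K : Type*) [Field K] [Countable K] :
    (∃ (Z : Set ℕ) (f : ℕ → NilConstruction.A K)
      (F U V : ℕ → Submodule K (NilConstruction.A K)),
        NilConstruction.IsConstruction Z f F U V) ∧
    ∀ (Z : Set ℕ) (f : ℕ → NilConstruction.A K)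
      (F U V : ℕ → Submodule K (NilConstruction.A K)),
        NilConstruction.IsConstruction Z f F U V →
          (NilConstruction.E U : Set (NilConstruction.A K)) ⊆ NilConstruction.Abar K ∧
          ∃ I : NilConstruction.AlgIdeal K (NilConstruction.Abar K),
            (∀ a : NilConstruction.Abar K,
              a ∈ I.toSubmodule ↔ (a : NilConstruction.A K) ∈ NilConstruction.E U) ∧
            NilConstruction.IsNilRing I.Quotient ∧
            ¬ FiniteDimensional K I.Quotient := by
  open NilConstruction in
  constructor
  · obtain ⟨Z, f, hf⟩ := exists_isSparseEnumeration K
    obtain ⟨F, hF⟩ := exists_isCapturing hf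
    obtain ⟨U, V, hUV⟩ := exists_isUVSystem hf hF
    exact ⟨Z, f, F, U, V, hf, hF, hUV⟩
  · rintro Z f F U V ⟨hf, hF, hUV⟩
    have hU := hUV.ideal_like
    refine ⟨fun x hx => E_le_Abar hx, idealE hU, mem_idealE hU, isNilRing_quotient hU ?_,
      infinite_quotient hU fun m => exists_notMem_Ecomp (hUV.U_le _) (hUV.V_le _)
        (hUV.disjoint _ (Nat.succ_pos m)) (hUV.V_ne_bot hf.five_le (Nat.succ_pos m))⟩
    intro g hg
    rw [← SetLike.mem_coe, ← hf.enumerates] at hg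
    obtain ⟨i, hi, rfl⟩ := hg
    have hpos : 0 < 2 ^ ex i := by positivity
    have hex : 0 < ex i := Nat.sub_pos_of_lt (log_lt_two_pow i)
    have hfi : f i ∈ Abar K := by
      rw [← SetLike.mem_coe, ← hf.enumerates]
      exact ⟨i, hi, rfl⟩
    -- The nilpotency criterion is stated with exponent `N + 1`, hence the shift by one.
    refine ⟨10 * (4 * 2 ^ ex i) - 1, ?_⟩
    rw [Nat.sub_add_cancel (by omega)]
    exact pow_mem_E hU hex (by omega) (hUV.F_le i hi) (hF.le_H i hi) hfi (hF.ideal_le i hi)
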